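/- **Setting.** A server holds $N$ files of $F$ bits each and is connected by an error-free broadcast link to $K_1\ge 1$ mirrors; each mirror $i$ is connected by an error-free broadcast link to its own $K_2\ge 1$ users $(i,1),\dots,(i,K_2)$, and $N\ge K_1K_2$. Each mirror has a memory of $M_1F$ bits and each user a cache of $M_2F$ bits, where $M_1,M_2\ge 0$ are real. In the placement phase the mirrors and caches are filled with functions of the files (possibly randomized), without knowledge of the requests. Then each user $(i,j)$ requests a file $d_{i,j}\in\{1,\dots,N\}$; the server broadcasts a message of at most $R_1F$ bits to the mirrors; each mirror $i$, from this message and its memory, broadcasts a message of at most $R_2F$ bits to its users; and each user estimates its requested file from its cache and the message of its mirror. All nodes may use the request matrix $\boldsymbol D=(d_{i,j})$ and the random seed of the scheme, which is independent of the files and the requests. The tuple $(M_1,M_2,R_1,R_2)$ is *feasible* if for every $\varepsilon>0$ and all sufficiently large $F$ there is such a scheme for which, for every request matrix, for all contents of the files and for every user $(i,j)$, user $(i,j)$ recovers its file with probability at least $1-\varepsilon$. Let $\mathcal R^\star(M_1,M_2)$ be the closure of the set of $(R_1,R_2)$ for which $(M_1,M_2,R_1,R_2)$ is feasible. Let $r(0,K)=K$,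 $r(p,K)=K(1-p)\cdot\frac{1}{Kp}\bigl(1-(1-p)^K\bigr)$ for $0<p\le 1$, and $r(p,K)=0$ for $p>1$. For $\alpha,\beta\in[0,1]$ let $$R_1(\alpha,\beta)=\alpha K_2\, r\!\left(\tfrac{M_1}{\alpha N},K_1\right)+(1-\alpha)\, r\!\left(\tfrac{(1-\beta)M_2}{(1-\alpha)N},K_1K_2\right),$$ $$R_2(\alpha,\beta)=\alpha\, r\!\left(\tfrac{\beta M_2}{\alpha N},K_2\right)+(1-\alpha)\, r\!\left(\tfrac{(1-\beta)M_2}{(1-\alpha)N},K_2\right),$$ where a term with weight $\alpha=0$ or $1-\alpha=0$ is $0$, and let $$\mathcal R_C(M_1,M_2)=\{(R_1(\alpha,\beta),R_2(\alpha,\beta)):\alpha,\beta\in[0,1]\}+\mathbb R_{+}^2,$$ where $\mathbb R_+^2$ is the closed positive quadrant. Let $$R_1^{\mathrm{lb}}=\max_{1\le s_1\le K_1,\ 1\le s_2\le K_2}\max\left\{s_1s_2\Bigl(1-\tfrac{s_1M_1+s_1s_2M_2}{N-s_1s_2}\Bigr),\ \tfrac{s_1s_2(N-s_1M_1-s_1s_2M_2)}{N+s_1s_2}\right\},\qquad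 R_2^{\mathrm{lb}}=\max_{1\le t\le K_2}\tfrac{t(N-tM_2)}{N+t},$$ where the first expression in the inner maximum is omitted if $s_1s_2=N$. Finally, for $M_1,M_2\le N$ let $(\alpha^\star,\beta^\star)$ be * $\bigl(\tfrac{M_1}{N},\tfrac{M_1}{N}\bigr)$ if $M_1+M_2K_2\ge N$ and $M_1\le N/4$; * $\bigl(\tfrac{M_1}{M_1+M_2K_2},0\bigr)$ if $M_1+M_2K_2<N$, read as $(0,0)$ if $M_1=M_2=0$; * $\bigl(\tfrac{M_1}{N},\tfrac14\bigr)$ if $M_1+M_2K_2\ge N$ and $M_1>N/4$. **Theorem.** Let $c_1=1/60$ and $c_2=16$. For all integers $K_1,K_2\ge1$, $N\ge K_1K_2$ and all real $M_1,M_2\ge 0$: 1. $\mathcal R_C(M_1,M_2)\subseteq\mathcal R^\star(M_1,M_2)\subseteq c_1\cdot\mathcal R_C(M_1,M_2)-c_2$, where $c_1\cdot A-c_2=\{(c_1a-c_2,\,c_1b-c_2):(a,b)\in A\}$. In particular the two regions agree up to absolute multiplicative and additive constants. 2. Every $(R_1,R_2)\in\mathcal R^\star(M_1,M_2)$ satisfies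 $R_1\ge R_1^{\mathrm{lb}}$ and $R_2\ge R_2^{\mathrm{lb}}$. 3. If $M_1\le N$ and $M_2\le N$, then $\alpha^\star,\beta^\star\in[0,1]$, and simultaneously $R_1^{\mathrm{lb}}\ge c_1R_1(\alpha^\star,\beta^\star)-c_2$ and $R_2^{\mathrm{lb}}\ge c_1R_2(\alpha^\star,\beta^\star)-c_2$. -/

import Mathlib

open scoped Pointwise

noncomputable section

namespace HierCaching

/-- Strings of `n` bits. -/
abbrev Bits (n : ℕ) : Type := Fin n → Bool

/-- A library of `N` files of `F` bits each. -/
abbrev Library (N F : ℕ) : Type := Fin N → Bits F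

/-- A request matrix: user `(i, j)` requests file `D i j`. -/
abbrev Requests (N K₁ K₂ : ℕ) : Type := Fin K₁ → Fin K₂ → Fin N

/-- A (possibly randomized) caching scheme for `N` files of `F` bits, `K₁` mirrors and `K₂` users
per mirror. Each mirror stores `a` bits, each user cache stores `b` bits, the server message has
`x` bits and every mirror message has `y` bits. The random seed of the placement and delivery
strategies is independent of the files and of the requests; all strategies may use it. The
placement (`mirror`, `cache`) does not depend on the requests. -/
structure Scheme (N K₁ K₂ F a b x y : ℕ) where
  /-- The number of values of the random seed. -/
  seeds : ℕ
  /-- The distribution of the random seed. -/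
  law : PMF (Fin seeds)
  /-- Placement phase: the contents of mirror `i`. -/
  mirror : Fin seeds → Library N F → (i : Fin K₁) → Bits a
  /-- Placement phase: the contents of user cache `(i, j)`. -/
  cache : Fin seeds → Library N F → (i : Fin K₁) → (j : Fin K₂) → Bits b
  /-- Delivery phase: the broadcast message of the server. -/
  server : Fin seeds → Requests N K₁ K₂ → Library N F → Bits x
  /-- Delivery phase: the broadcast message of mirror `i`, computed from the server message and
  the contents of mirror `i`. -/
  relay : Fin seeds → Requests N K₁ K₂ → (i : Fin K₁) → Bits x → Bits a → Bits y
  /-- The reconstruction of user `(i, j)`, computed from the message of mirror `i` and the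
  contents of cache `(i, j)`. -/
  decode : Fin seeds → Requests N K₁ K₂ → (i : Fin K₁) → (j : Fin K₂) → Bits y → Bits b → Bits F

namespace Scheme

variable {N K₁ K₂ F a b x y : ℕ}

/-- What user `(i, j)` reconstructs for seed `ω`, requests `D` and files `W`. -/
def output (S : Scheme N K₁ K₂ F a b x y) (ω : Fin S.seeds) (D : Requests N K₁ K₂)
    (W : Library N F) (i : Fin K₁) (j : Fin K₂) : Bits F :=
  S.decode ω D i j (S.relay ω D i (S.server ω D W) (S.mirror ω W i)) (S.cache ω W i j)

/-- The probability that user `(i, j)` recovers its requested file. -/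
def successProb (S : Scheme N K₁ K₂ F a b x y) (D : Requests N K₁ K₂)
    (W : Library N F) (i : Fin K₁) (j : Fin K₂) : ℝ :=
  (S.law.toOuterMeasure {ω | S.output ω D W i j = W (D i j)}).toReal

end Scheme

/-- The tuple `(M₁, M₂, R₁, R₂)` is feasible: for all large file sizes `F` there is a scheme with
mirrors of at most `M₁ F` bits, user caches of at most `M₂ F` bits, a server message of at most
`R₁ F` bits and mirror messages of at most `R₂ F` bits, such that for every request matrix each
user recovers its requested file with probability arbitrarily close to one. -/
def Feasible (N K₁ K₂ : ℕ) (M₁ M₂ R₁ R₂ : ℝ) : Prop :=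
  ∀ ε : ℝ, 0 < ε → ∃ F₀ : ℕ, ∀ F : ℕ, F₀ ≤ F →
    ∃ a b x y : ℕ, (a : ℝ) ≤ M₁ * F ∧ (b : ℝ) ≤ M₂ * F ∧ (x : ℝ) ≤ R₁ * F ∧ (y : ℝ) ≤ R₂ * F ∧
      ∃ S : Scheme N K₁ K₂ F a b x y,
        ∀ (D : Requests N K₁ K₂) (W : Library N F) (i : Fin K₁) (j : Fin K₂),
          1 - ε ≤ S.successProb D W i j

/-- The feasible rate region. -/
def feasibleRegion (N K₁ K₂ : ℕ) (M₁ M₂ : ℝ) : Set (ℝ × ℝ) :=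
  closure {R : ℝ × ℝ | Feasible N K₁ K₂ M₁ M₂ R.1 R.2}

/-- The single-layer coded caching rate `r(p, K)` for normalized memory `p = M / N`. At `p = 0` it
is the limit `K`, and no transmission is needed once `p ≥ 1`. -/
def baseRate (p : ℝ) (K : ℕ) : ℝ :=
  if p = 0 then K
  else if p ≤ 1 then K * (1 - p) * (1 / (K * p) * (1 - (1 - p) ^ K))
  else 0

/-- The rate `R₁(α, β)`; a term with zero weight (`α = 0` or `1 - α = 0`) vanishes. -/
def rate₁ (N K₁ K₂ : ℕ) (M₁ M₂ α β : ℝ) : ℝ :=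
  α * K₂ * baseRate (M₁ / (α * N)) K₁ +
    (1 - α) * baseRate ((1 - β) * M₂ / ((1 - α) * N)) (K₁ * K₂)

/-- The rate `R₂(α, β)`; a term with zero weight (`α = 0` or `1 - α = 0`) vanishes. -/
def rate₂ (N K₂ : ℕ) (M₂ α β : ℝ) : ℝ :=
  α * baseRate (β * M₂ / (α * N)) K₂ +
    (1 - α) * baseRate ((1 - β) * M₂ / ((1 - α) * N)) K₂

/-- The region `R_C(M₁, M₂)`: all pairs `(R₁(α, β), R₂(α, β))` with `α, β ∈ [0, 1]`, plus the
positive quadrant (Minkowski sum). -/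
def achievableRegion (N K₁ K₂ : ℕ) (M₁ M₂ : ℝ) : Set (ℝ × ℝ) :=
  {R : ℝ × ℝ | ∃ α ∈ Set.Icc (0 : ℝ) 1, ∃ β ∈ Set.Icc (0 : ℝ) 1,
      R = (rate₁ N K₁ K₂ M₁ M₂ α β, rate₂ N K₂ M₂ α β)} +
    {Q : ℝ × ℝ | 0 ≤ Q.1 ∧ 0 ≤ Q.2}

/-- The set `c₁ · A - c₂`, coordinatewise. -/
def scaleShift (c₁ c₂ : ℝ) (A : Set (ℝ × ℝ)) : Set (ℝ × ℝ) :=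
  (fun R : ℝ × ℝ => (c₁ * R.1 - c₂, c₁ * R.2 - c₂)) '' A

/-- The parameters `(α⋆, β⋆)` in the three memory regimes
(II: `M₁ + M₂ K₂ < N`; otherwise I: `M₁ ≤ N / 4`, III: `N / 4 < M₁`).
For `M₁ = M₂ = 0` the value is `(0, 0)`. -/
def starParams (N K₂ : ℕ) (M₁ M₂ : ℝ) : ℝ × ℝ :=
  if M₁ + M₂ * K₂ < N then (M₁ / (M₁ + M₂ * K₂), 0)
  else if M₁ ≤ N / 4 then (M₁ / N, M₁ / N)
  else (M₁ / N, 1 / 4)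

/-- The cut-set bound on `R₁` from `s₁` mirrors and `s₂` users at each of them. The first of the
two expressions is only present when `s₁ s₂ < N`. -/
def cutSet₁ (N : ℕ) (M₁ M₂ : ℝ) (s₁ s₂ : ℕ) : ℝ :=
  if s₁ * s₂ < N then
    max ((s₁ * s₂ : ℝ) * (1 - (s₁ * M₁ + s₁ * s₂ * M₂) / (N - s₁ * s₂)))
      ((s₁ * s₂ : ℝ) * (N - s₁ * M₁ - s₁ * s₂ * M₂) / (N + s₁ * s₂))
  else (s₁ * s₂ : ℝ) * (N - s₁ * M₁ - s₁ * s₂ * M₂) / (N + s₁ * s₂)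

/-- The cut-set lower bound on `R₁`: the maximum over `1 ≤ s₁ ≤ K₁` and `1 ≤ s₂ ≤ K₂`. -/
def lowerBound₁ (N K₁ K₂ : ℕ) (M₁ M₂ : ℝ) : ℝ :=
  ⨆ s : Fin K₁ × Fin K₂, cutSet₁ N M₁ M₂ ((s.1 : ℕ) + 1) ((s.2 : ℕ) + 1)

/-- The cut-set lower bound on `R₂`: the maximum over `1 ≤ t ≤ K₂`. -/
def lowerBound₂ (N K₂ : ℕ) (M₂ : ℝ) : ℝ :=
  ⨆ t : Fin K₂, (((t : ℕ) + 1 : ℕ) : ℝ) * (N - ((t : ℕ) + 1 : ℕ) * M₂) / (N + ((t : ℕ) + 1 : ℕ))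

end HierCaching

end

/-! Achievability. Each file is split into parts of relative size `α` and `1 - α`, and each user
cache is split by `β`. The first part is delivered by single-layer coded caching twice: from the
server to the mirrors, once for each user index `j`, and then from each mirror to its users. The
second part is coded for all `K₁K₂` users at once, each mirror forwarding only the coded bits that
concern its own users. Replacing random placement by deterministic subfiles of the expected sizes
gives a zero-error scheme whose overhead does not depend on `F` (`exists_zero_error_scheme`,
`exists_placement`).

Converse. The memories do not depend on the requests, so the same `s₁` mirrors and `s₁s₂` caches
serve `ρ` successive request matrices for distinct files. Together with `ρ` server messages they
determine `ρs₁s₂` files, and comparing bits bounds the rate (`Scheme.cutSet_server`,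
`Scheme.cutSet_relay`). For random schemes one fixes a seed that works for half of the libraries.
This costs one bit, negligible against `F`.

Order optimality. The comparison needs little more than `r(p, K) ≤ K` and `r(p, K) ≤ (1 - p) / p`.
In each memory regime a cut whose size is about the inverse of the relevant normalized memory
matches these bounds up to constants (the `scaled_le_lowerBound` lemmas). When this inverse is
bounded, so is the rate, and the additive constant absorbs it. -/

namespace HierCaching

/-! ### Converse: cut-set bounds by counting libraries -/

theorem PMF_toOuterMeasure_toReal {n : ℕ} (law : PMF (Fin n)) (A : Set (Fin n)) :
    (law.toOuterMeasure A).toReal = ∑ ω, A.indicator (fun ω => (law ω).toReal) ω := by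
  rw [PMF.toOuterMeasure_apply_fintype, ENNReal.toReal_sum]
  · refine Finset.sum_congr rfl fun ω _ => ?_
    by_cases h : ω ∈ A <;> simp [h]
  · intro ω _
    by_cases h : ω ∈ A <;> simp [h, PMF.apply_ne_top]

theorem PMF_sum_toReal {n : ℕ} (law : PMF (Fin n)) : ∑ ω, (law ω).toReal = 1 := by
  rw [← ENNReal.toReal_sum fun ω _ => PMF.apply_ne_top _ _]
  have h := law.tsum_coe
  rw [tsum_fintype] at h
  simp [h]

open Classical in
/-- If each of finitely many events has small failure probability for every outcome `w`, then some
seed is good for at least half of the outcomes. -/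
theorem exists_seed_half_good {n : ℕ} (law : PMF (Fin n)) {Ω Q : Type*} [Fintype Ω] [Fintype Q]
    (A : Q → Fin n → Ω → Prop) (ε : ℝ) (hε : Fintype.card Q * ε ≤ 1 / 2)
    (h : ∀ q w, 1 - ε ≤ (law.toOuterMeasure {ω | A q ω w}).toReal) :
    ∃ ω, Fintype.card Ω ≤ 2 * (Finset.univ.filter fun w => ∀ q, A q ω w).card := by
  by_contra! hcon
  have hp : ∀ ω, 0 ≤ (law ω).toReal := fun ω => ENNReal.toReal_nonneg
  have hs := PMF_sum_toReal law
  -- Union bound for each fixed outcome; exchanging the sums over outcomes and seeds then averages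
  -- over the seeds.
  have h1 : ∀ w, (1 / 2 : ℝ) ≤ ∑ ω, (law ω).toReal * (if ∀ q, A q ω w then 1 else 0) := by
    intro w
    have hq : ∀ q, ∑ ω, (law ω).toReal * (if A q ω w then 0 else 1) ≤ ε := by
      intro q
      have := h q w
      rw [PMF_toOuterMeasure_toReal] at this
      have h2 : ∑ ω, (law ω).toReal * (if A q ω w then 0 else 1) +
          ∑ ω, Set.indicator {ω | A q ω w} (fun ω => (law ω).toReal) ω = 1 := by
        rw [← Finset.sum_add_distrib]
        refine Eq.trans ?_ hs
        refine Finset.sum_congr rfl fun ω _ => ?_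
        by_cases hA : A q ω w <;> simp [hA]
      linarith
    have hsum : ∑ q, ∑ ω, (law ω).toReal * (if A q ω w then 0 else 1) ≤ 1 / 2 := by
      refine (Finset.sum_le_sum fun q _ => hq q).trans ?_
      simpa using hε
    rw [Finset.sum_comm] at hsum
    have h3 : (1 : ℝ) ≤ ∑ ω, (law ω).toReal * (if ∀ q, A q ω w then 1 else 0) +
        ∑ ω, ∑ q, (law ω).toReal * (if A q ω w then 0 else 1) := by
      rw [← Finset.sum_add_distrib]
      refine hs.ge.trans ?_
      refine Finset.sum_le_sum fun ω _ => ?_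
      by_cases hA : ∀ q, A q ω w
      · simp [hA]
      · rw [if_neg hA]
        push Not at hA
        obtain ⟨q, hq⟩ := hA
        have := Finset.single_le_sum (f := fun q => (law ω).toReal * (if A q ω w then 0 else 1))
          (fun q _ => mul_nonneg (hp ω) (by split_ifs <;> norm_num)) (Finset.mem_univ q)
        simp only [if_neg hq, mul_one] at this
        linarith
    linarith
  have h2 : (Fintype.card Ω : ℝ) * (1 / 2) ≤
      ∑ w : Ω, ∑ ω, (law ω).toReal * (if ∀ q, A q ω w then 1 else 0) := by
    have := Finset.sum_le_sum fun w (_ : w ∈ Finset.univ) => h1 w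
    simpa using this
  rw [Finset.sum_comm] at h2
  have h3 : ∀ ω, ∑ w : Ω, (law ω).toReal * (if ∀ q, A q ω w then (1 : ℝ) else 0) ≤
      (law ω).toReal * (((Fintype.card Ω : ℝ) - 1) / 2) := by
    intro ω
    rw [← Finset.mul_sum]
    refine mul_le_mul_of_nonneg_left ?_ (hp ω)
    rw [Finset.sum_boole]
    -- Integrality of `hcon` gains a full unit, so the averaged inequality stays strict even though
    -- seeds may have probability zero.
    have : 2 * (Finset.univ.filter fun w => ∀ q, A q ω w).card + 1 ≤ Fintype.card Ω := hcon ω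
    have : (2 * (Finset.univ.filter fun w => ∀ q, A q ω w).card + 1 : ℝ) ≤ Fintype.card Ω := by
      exact_mod_cast this
    linarith
  have h4 := h2.trans (Finset.sum_le_sum fun ω _ => h3 ω)
  rw [← Finset.sum_mul, hs] at h4
  linarith

/-- If the libraries on which finitely many users succeed are determined by `k` bits, then the
libraries have at most `k + 1` bits. -/
theorem Scheme.library_bits_le {N K₁ K₂ F a b x y : ℕ} (S : Scheme N K₁ K₂ F a b x y) {Q : Type*}
    [Fintype Q] (D : Q → Requests N K₁ K₂) (i : Q → Fin K₁) (j : Q → Fin K₂) (ε : ℝ)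
    (hε : Fintype.card Q * ε ≤ 1 / 2)
    (hS : ∀ (D : Requests N K₁ K₂) (W : Library N F) (i : Fin K₁) (j : Fin K₂),
      1 - ε ≤ S.successProb D W i j)
    {T : Type*} [Fintype T] (k : ℕ) (hT : Fintype.card T = 2 ^ k)
    (f : Fin S.seeds → Library N F → T)
    (hf : ∀ ω W W', f ω W = f ω W' →
      (∀ q, S.output ω (D q) W (i q) (j q) = W (D q (i q) (j q))) →
      (∀ q, S.output ω (D q) W' (i q) (j q) = W' (D q (i q) (j q))) → W = W') :
    N * F ≤ k + 1 := by
  classical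
  obtain ⟨ω, hω⟩ := exists_seed_half_good S.law
    (fun q ω W => S.output ω (D q) W (i q) (j q) = W (D q (i q) (j q))) ε hε
    (fun q W => hS (D q) W (i q) (j q))
  have hc : (Finset.univ.filter fun W : Library N F =>
      ∀ q, S.output ω (D q) W (i q) (j q) = W (D q (i q) (j q))).card ≤ 2 ^ k := by
    rw [← hT, ← Finset.card_univ]
    refine Finset.card_le_card_of_injOn (f ω) (fun _ _ => Finset.mem_coe.2 (Finset.mem_univ _)) ?_
    intro W hW W' hW' h
    simp only [Finset.coe_filter, Finset.mem_univ, true_and, Set.mem_ofPred_eq] at hW hW'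
    exact hf ω W W' h hW hW'
  have hl : Fintype.card (Library N F) = 2 ^ (N * F) := by
    simp [Library, Bits, ← pow_mul, mul_comm]
  rw [hl] at hω
  -- Only half of the libraries are known to inject into `T`; this is the extra bit.
  have : 2 ^ (N * F) ≤ 2 ^ (k + 1) := by
    refine hω.trans ?_
    rw [pow_succ, mul_comm (2 ^ k)]
    refine Nat.mul_le_mul_left 2 ?_
    convert hc
  exact (Nat.pow_le_pow_iff_right (by norm_num)).1 this

/-- In round `c`, the user with index `i s₂ + j` requests file `c s + i s₂ + j`. -/
def cutRequests (N K₁ K₂ s s₂ : ℕ) (hN : 0 < N) (c : ℕ) : Requests N K₁ K₂ :=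
  fun i j => ⟨(c * s + i * s₂ + j) % N, Nat.mod_lt _ hN⟩

/-- Mixed-radix digits of `n`: they name the round, mirror and user that decode file `n`. -/
theorem exists_cut_user {s₁ s₂ ρ n : ℕ} (hn : n < ρ * (s₁ * s₂)) :
    ∃ (c : Fin ρ) (i : Fin s₁) (j : Fin s₂), c * (s₁ * s₂) + i * s₂ + j = n := by
  have hs : 0 < s₁ * s₂ := by
    by_contra! h
    simp [Nat.le_zero.1 h] at hn
  have hs₂ : 0 < s₂ := Nat.pos_of_mul_pos_left hs
  refine ⟨⟨n / (s₁ * s₂), Nat.div_lt_of_lt_mul (by rwa [mul_comm])⟩,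
    ⟨n % (s₁ * s₂) / s₂, Nat.div_lt_of_lt_mul (by rw [mul_comm s₂]; exact Nat.mod_lt n hs)⟩,
    ⟨n % (s₁ * s₂) % s₂, Nat.mod_lt _ hs₂⟩, ?_⟩
  simp only
  have h1 := Nat.div_add_mod n (s₁ * s₂)
  have h2 := Nat.div_add_mod (n % (s₁ * s₂)) s₂
  rw [mul_comm] at h1 h2
  omega

theorem card_rest (N m : ℕ) : Fintype.card {n : Fin N // m ≤ n} = N - m := by
  rw [Fintype.card_subtype]
  have := Fin.card_filter_val_lt (n := N) (m := m)
  have h2 := Finset.card_filter_add_card_filter_not (s := (Finset.univ : Finset (Fin N)))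
    (fun n : Fin N => (n : ℕ) < m)
  simp only [not_lt, Finset.card_univ, Fintype.card_fin] at h2
  omega

/-- The files not requested in any round are recorded verbatim, so that the whole library is
determined. The truncated subtraction makes this term vanish when the rounds cover all files;
requests that wrap around modulo `N` are never needed for decoding. -/
theorem Scheme.cutSet_server {N K₁ K₂ F a b x y : ℕ} (S : Scheme N K₁ K₂ F a b x y)
    (hN : 0 < N) {s₁ s₂ : ℕ} (h₁ : s₁ ≤ K₁) (h₂ : s₂ ≤ K₂) (ρ : ℕ) (ε : ℝ)
    (hε : (ρ * (s₁ * s₂) : ℕ) * ε ≤ 1 / 2)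
    (hS : ∀ (D : Requests N K₁ K₂) (W : Library N F) (i : Fin K₁) (j : Fin K₂),
      1 - ε ≤ S.successProb D W i j) :
    N * F ≤ (ρ * x + s₁ * a + s₁ * s₂ * b + (N - ρ * (s₁ * s₂)) * F) + 1 := by
  have hc := card_rest N (ρ * (s₁ * s₂))
  refine S.library_bits_le (Q := Fin ρ × Fin s₁ × Fin s₂)
    (fun q => cutRequests N K₁ K₂ (s₁ * s₂) s₂ hN q.1)
    (fun q => q.2.1.castLE h₁) (fun q => q.2.2.castLE h₂) ε (by simpa using hε) hS
    (T := (Fin ρ → Bits x) × (Fin s₁ → Bits a) × (Fin s₁ → Fin s₂ → Bits b) ×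
      ({n : Fin N // ρ * (s₁ * s₂) ≤ n} → Bits F)) _ ?_
    (fun ω W => (fun c => S.server ω (cutRequests N K₁ K₂ (s₁ * s₂) s₂ hN c) W,
      fun i => S.mirror ω W (i.castLE h₁),
      fun i j => S.cache ω W (i.castLE h₁) (j.castLE h₂), fun n => W n)) ?_
  · simp [Bits, hc, ← pow_mul]
    ring
  · intro ω W W' h hW hW'
    simp only [Prod.mk.injEq] at h
    obtain ⟨e1, e2, e3, e4⟩ := h
    funext n
    by_cases hn : (n : ℕ) < ρ * (s₁ * s₂)
    · obtain ⟨c, i, j, hcij⟩ := exists_cut_user hn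
      have hD : cutRequests N K₁ K₂ (s₁ * s₂) s₂ hN c (i.castLE h₁) (j.castLE h₂) = n := by
        apply Fin.ext
        simp [cutRequests, hcij, Nat.mod_eq_of_lt n.2]
      have g1 := hW (c, i, j)
      have g2 := hW' (c, i, j)
      simp only [hD] at g1 g2
      rw [← g1, ← g2]
      simp only [Scheme.output]
      rw [congrFun e1 c, congrFun e2 i, congrFun (congrFun e3 i) j]
    · exact congrFun e4 ⟨n, not_lt.1 hn⟩

theorem Scheme.cutSet_relay {N K₁ K₂ F a b x y : ℕ} (S : Scheme N K₁ K₂ F a b x y)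
    (hN : 0 < N) (hK₁ : 1 ≤ K₁) {t : ℕ} (ht : t ≤ K₂) (ρ : ℕ) (ε : ℝ)
    (hε : (ρ * t : ℕ) * ε ≤ 1 / 2)
    (hS : ∀ (D : Requests N K₁ K₂) (W : Library N F) (i : Fin K₁) (j : Fin K₂),
      1 - ε ≤ S.successProb D W i j) :
    N * F ≤ (ρ * y + t * b + (N - ρ * t) * F) + 1 := by
  have hc := card_rest N (ρ * t)
  refine S.library_bits_le (Q := Fin ρ × Fin t)
    -- With `s₂ = 0` the request does not depend on the mirror; only mirror `0` is in the cut.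
    (fun q => cutRequests N K₁ K₂ t 0 hN q.1)
    (fun q => ⟨0, hK₁⟩) (fun q => q.2.castLE ht) ε (by simpa using hε) hS
    (T := (Fin ρ → Bits y) × (Fin t → Bits b) × ({n : Fin N // ρ * t ≤ n} → Bits F)) _ ?_
    (fun ω W => (fun c => S.relay ω (cutRequests N K₁ K₂ t 0 hN c) ⟨0, hK₁⟩
        (S.server ω (cutRequests N K₁ K₂ t 0 hN c) W) (S.mirror ω W ⟨0, hK₁⟩),
      fun j => S.cache ω W ⟨0, hK₁⟩ (j.castLE ht), fun n => W n)) ?_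
  · simp [Bits, hc, ← pow_mul]
    ring
  · intro ω W W' h hW hW'
    simp only [Prod.mk.injEq] at h
    obtain ⟨e1, e2, e3⟩ := h
    funext n
    by_cases hn : (n : ℕ) < ρ * t
    · obtain ⟨c, i, j, hcij⟩ := exists_cut_user (s₁ := 1) (s₂ := t) (by simpa using hn)
      have hi : (i : ℕ) = 0 := by omega
      simp only [hi, one_mul, zero_mul, add_zero] at hcij
      have hD : cutRequests N K₁ K₂ t 0 hN c ⟨0, hK₁⟩ (j.castLE ht) = n := by
        apply Fin.ext
        simp [cutRequests, hcij, Nat.mod_eq_of_lt n.2]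
      have g1 := hW (c, j)
      have g2 := hW' (c, j)
      simp only [hD] at g1 g2
      rw [← g1, ← g2]
      simp only [Scheme.output]
      have := congrFun e1 c
      beta_reduce at this
      rw [this, congrFun e2 j]
    · exact congrFun e3 ⟨n, not_lt.1 hn⟩

theorem le_of_eventually_mul_le {A C : ℝ} {F₀ : ℕ}
    (h : ∀ F : ℕ, F₀ ≤ F → A * F ≤ C * F + 1) : A ≤ C := by
  by_contra! hlt
  obtain ⟨n, hn⟩ := exists_nat_gt (1 / (A - C))
  have hn' := h (max n F₀) (le_max_right _ _)
  have h1 : (n : ℝ) ≤ (max n F₀ : ℕ) := by exact_mod_cast le_max_left _ _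
  have h2 : 1 / (A - C) < (max n F₀ : ℕ) := hn.trans_le h1
  rw [div_lt_iff₀ (by linarith)] at h2
  nlinarith

theorem Feasible.nonneg {N K₁ K₂ : ℕ} {M₁ M₂ R₁ R₂ : ℝ} (h : Feasible N K₁ K₂ M₁ M₂ R₁ R₂) :
    0 ≤ R₁ ∧ 0 ≤ R₂ := by
  obtain ⟨F₀, h⟩ := h 1 one_pos
  obtain ⟨a, b, x, y, -, -, hx, hy, -⟩ := h (F₀ + 1) (by omega)
  have hF : (0 : ℝ) < (F₀ + 1 : ℕ) := by positivity
  constructor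
  · exact nonneg_of_mul_nonneg_left (le_trans (Nat.cast_nonneg x) hx) hF
  · exact nonneg_of_mul_nonneg_left (le_trans (Nat.cast_nonneg y) hy) hF

theorem Feasible.cutSet_server {N K₁ K₂ : ℕ} {M₁ M₂ R₁ R₂ : ℝ}
    (h : Feasible N K₁ K₂ M₁ M₂ R₁ R₂) (hN : 0 < N) {s₁ s₂ : ℕ} (h₁ : s₁ ≤ K₁) (h₂ : s₂ ≤ K₂)
    (ρ : ℕ) :
    (N : ℝ) ≤ ρ * R₁ + s₁ * M₁ + s₁ * s₂ * M₂ + (N - ρ * (s₁ * s₂) : ℕ) := by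
  -- This error level leaves total failure probability at most one half over all users and rounds;
  -- the `+ 1` avoids division by zero.
  obtain ⟨F₀, h⟩ := h (1 / (2 * ((ρ * (s₁ * s₂) : ℕ) + 1))) (by positivity)
  refine le_of_eventually_mul_le (F₀ := F₀) fun F hF => ?_
  obtain ⟨a, b, x, y, ha, hb, hx, hy, S, hS⟩ := h F hF
  have key := S.cutSet_server hN h₁ h₂ ρ _ (by
    rw [mul_one_div, div_le_div_iff₀ (by positivity) (by norm_num)]
    linarith) hS
  have key' : (N : ℝ) * F ≤
      (ρ * x + s₁ * a + s₁ * s₂ * b + (N - ρ * (s₁ * s₂) : ℕ) * F) + 1 := by exact_mod_cast key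
  have e1 := mul_le_mul_of_nonneg_left hx (Nat.cast_nonneg (α := ℝ) ρ)
  have e2 := mul_le_mul_of_nonneg_left ha (Nat.cast_nonneg (α := ℝ) s₁)
  have e3 := mul_le_mul_of_nonneg_left hb
    (mul_nonneg (Nat.cast_nonneg (α := ℝ) s₁) (Nat.cast_nonneg (α := ℝ) s₂))
  linarith

theorem Feasible.cutSet_relay {N K₁ K₂ : ℕ} {M₁ M₂ R₁ R₂ : ℝ}
    (h : Feasible N K₁ K₂ M₁ M₂ R₁ R₂) (hN : 0 < N) (hK₁ : 1 ≤ K₁) {t : ℕ} (ht : t ≤ K₂)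
    (ρ : ℕ) :
    (N : ℝ) ≤ ρ * R₂ + t * M₂ + (N - ρ * t : ℕ) := by
  obtain ⟨F₀, h⟩ := h (1 / (2 * ((ρ * t : ℕ) + 1))) (by positivity)
  refine le_of_eventually_mul_le (F₀ := F₀) fun F hF => ?_
  obtain ⟨a, b, x, y, ha, hb, hx, hy, S, hS⟩ := h F hF
  have key := S.cutSet_relay hN hK₁ ht ρ _ (by
    rw [mul_one_div, div_le_div_iff₀ (by positivity) (by norm_num)]
    linarith) hS
  have key' : (N : ℝ) * F ≤ (ρ * y + t * b + (N - ρ * t : ℕ) * F) + 1 := by exact_mod_cast key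
  have e1 := mul_le_mul_of_nonneg_left hy (Nat.cast_nonneg (α := ℝ) ρ)
  have e3 := mul_le_mul_of_nonneg_left hb (Nat.cast_nonneg (α := ℝ) t)
  linarith

/-- The cut-set inequality with `⌈N / s⌉` rounds, solved for the rate. -/
theorem cutSet_le_of_ceil {N s : ℕ} (hs : 0 < s) {R c : ℝ} (hR : 0 ≤ R)
    (h : ∀ ρ : ℕ, (N : ℝ) ≤ ρ * R + c + (N - ρ * s : ℕ)) :
    s * (N - c) / (N + s) ≤ R := by
  have hs' : (0 : ℝ) < s := by exact_mod_cast hs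
  -- If `s` divides `N` this is one round more than the ceiling. All that matters is that the rounds
  -- cover every file and that their number is at most `(N + s) / s`.
  have h1 := h (N / s + 1)
  have h2 : N - (N / s + 1) * s = 0 := by
    have := Nat.lt_div_mul_add hs (a := N)
    rw [add_mul, one_mul]
    omega
  rw [h2] at h1
  have h3 : ((N / s : ℕ) : ℝ) * s ≤ N := by exact_mod_cast Nat.div_mul_le_self N s
  push_cast at h1
  rw [div_le_iff₀ (by positivity)]
  nlinarith

/-- The cut-set inequality with `⌊N / s⌋` rounds, solved for the rate. -/
theorem cutSet_le_of_floor {N s : ℕ} (hs : 0 < s) (hsN : s < N) {R c : ℝ} (hc : 0 ≤ c)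
    (h : ∀ ρ : ℕ, (N : ℝ) ≤ ρ * R + c + (N - ρ * s : ℕ)) :
    s * (1 - c / (N - s)) ≤ R := by
  have hs' : (0 : ℝ) < s := by exact_mod_cast hs
  have hsN' : (0 : ℝ) < N - s := by
    have : (s : ℝ) < N := by exact_mod_cast hsN
    linarith
  have h1 := h (N / s)
  have h3 : ((N / s : ℕ) : ℝ) * s ≤ N := by exact_mod_cast Nat.div_mul_le_self N s
  have h4 : (N : ℝ) ≤ ((N / s : ℕ) : ℝ) * s + s := by
    exact_mod_cast (Nat.lt_div_mul_add hs (a := N)).le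
  rw [Nat.cast_sub (Nat.div_mul_le_self N s)] at h1
  push_cast at h1 h3 h4
  set ρ : ℝ := ((N / s : ℕ) : ℝ)
  have hρ : 0 < ρ := by
    by_contra! hle
    nlinarith
  have h5 : ρ * (s - R) ≤ c := by linarith
  have h6 : s - R ≤ c / ρ := by rw [le_div_iff₀ hρ]; linarith
  have h7 : c / ρ ≤ s * (c / (N - s)) := by
    rw [← mul_div_assoc, div_le_div_iff₀ hρ hsN']
    nlinarith
  linarith

theorem Feasible.lowerBound_le {N K₁ K₂ : ℕ} {M₁ M₂ R₁ R₂ : ℝ}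
    (h : Feasible N K₁ K₂ M₁ M₂ R₁ R₂) (hK₁ : 1 ≤ K₁) (hK₂ : 1 ≤ K₂) (hN : K₁ * K₂ ≤ N)
    (hM₁ : 0 ≤ M₁) (hM₂ : 0 ≤ M₂) :
    lowerBound₁ N K₁ K₂ M₁ M₂ ≤ R₁ ∧ lowerBound₂ N K₂ M₂ ≤ R₂ := by
  have hN0 : 0 < N := lt_of_lt_of_le (Nat.mul_pos hK₁ hK₂) hN
  have : Nonempty (Fin K₁ × Fin K₂) := ⟨(⟨0, hK₁⟩, ⟨0, hK₂⟩)⟩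
  have : Nonempty (Fin K₂) := ⟨⟨0, hK₂⟩⟩
  constructor
  · refine ciSup_le fun s => ?_
    obtain ⟨i, j⟩ := s
    have hs : 0 < ((i : ℕ) + 1) * ((j : ℕ) + 1) := by positivity
    have key : ∀ ρ : ℕ, (N : ℝ) ≤ ρ * R₁ + ((((i : ℕ) + 1 : ℕ) : ℝ) * M₁ +
        (((i : ℕ) + 1 : ℕ) : ℝ) * (((j : ℕ) + 1 : ℕ) : ℝ) * M₂) +
        (N - ρ * (((i : ℕ) + 1) * ((j : ℕ) + 1)) : ℕ) := fun ρ => by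
      have := h.cutSet_server hN0 (s₁ := i + 1) (s₂ := j + 1) i.2 j.2 ρ
      linarith
    have h2 := cutSet_le_of_ceil hs h.nonneg.1 key
    have h3 := fun hlt => cutSet_le_of_floor hs hlt (by positivity) key
    rw [Nat.cast_mul, ← sub_sub] at h2
    rw [Nat.cast_mul] at h3
    unfold cutSet₁
    split_ifs with hlt
    · exact max_le (h3 hlt) h2
    · exact h2
  · refine ciSup_le fun t => ?_
    refine (le_of_eq ?_).trans (cutSet_le_of_ceil (N := N) (s := t + 1) (by omega) h.nonneg.2
      (c := ((t + 1 : ℕ) : ℝ) * M₂) (h.cutSet_relay hN0 hK₁ t.2))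
    push_cast
    ring

theorem lowerBound_le_of_mem_feasibleRegion {N K₁ K₂ : ℕ} {M₁ M₂ : ℝ}
    (hK₁ : 1 ≤ K₁) (hK₂ : 1 ≤ K₂) (hN : K₁ * K₂ ≤ N) (hM₁ : 0 ≤ M₁) (hM₂ : 0 ≤ M₂)
    {R : ℝ × ℝ} (hR : R ∈ feasibleRegion N K₁ K₂ M₁ M₂) :
    lowerBound₁ N K₁ K₂ M₁ M₂ ≤ R.1 ∧ lowerBound₂ N K₂ M₂ ≤ R.2 := by
  have hcl : IsClosed {R : ℝ × ℝ | lowerBound₁ N K₁ K₂ M₁ M₂ ≤ R.1 ∧ lowerBound₂ N K₂ M₂ ≤ R.2} :=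
    (isClosed_le continuous_const continuous_fst).inter
      (isClosed_le continuous_const continuous_snd)
  exact closure_minimal (fun R hR => hR.lowerBound_le hK₁ hK₂ hN hM₁ hM₂) hcl hR

/-! ### Elementary bounds on the single-layer rate -/

theorem baseRate_of_pos {p : ℝ} {K : ℕ} (hp : 0 < p) (hp1 : p ≤ 1) (hK : 1 ≤ K) :
    baseRate p K = (1 - p) / p * (1 - (1 - p) ^ K) := by
  have hK' : (K : ℝ) ≠ 0 := by positivity
  rw [baseRate, if_neg hp.ne', if_pos hp1]
  field_simp

theorem baseRate_of_one_le {p : ℝ} {K : ℕ} (hp : 1 ≤ p) : baseRate p K = 0 := by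
  rw [baseRate, if_neg (by linarith)]
  split_ifs with h
  · rw [le_antisymm h hp]
    simp
  · rfl

theorem baseRate_nonneg {p : ℝ} {K : ℕ} (hp : 0 ≤ p) : 0 ≤ baseRate p K := by
  rw [baseRate]
  split_ifs with h0 h1
  · positivity
  · have : (1 - p) ^ K ≤ 1 := pow_le_one₀ (by linarith) (by linarith)
    have h2 : 0 ≤ 1 - p := by linarith
    have h3 : 0 ≤ 1 - (1 - p) ^ K := by linarith
    positivity
  · exact le_rfl

theorem baseRate_le_natCast {p : ℝ} {K : ℕ} (hp : 0 ≤ p) (hK : 1 ≤ K) : baseRate p K ≤ K := by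
  rcases hp.eq_or_lt with rfl | hp
  · simp [baseRate]
  rcases le_total 1 p with h1 | h1
  · rw [baseRate_of_one_le h1]
    positivity
  · rw [baseRate_of_pos hp h1 hK]
    -- Bernoulli's inequality: `1 - (1 - p) ^ K ≤ K * p`.
    have hb := one_add_mul_le_pow (a := -p) (by linarith) K
    rw [← sub_eq_add_neg] at hb
    have h2 : (1 - p) / p * (1 - (1 - p) ^ K) ≤ (1 - p) / p * (K * p) :=
      mul_le_mul_of_nonneg_left (by linarith) (div_nonneg (by linarith) hp.le)
    have h3 : (1 - p) / p * (K * p) = (1 - p) * K := by field_simp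
    have : (0 : ℝ) ≤ K := Nat.cast_nonneg _
    nlinarith

theorem mul_baseRate_le {p : ℝ} {K : ℕ} (hp : 0 ≤ p) (hp1 : p ≤ 1) (hK : 1 ≤ K) :
    p * baseRate p K ≤ 1 - p := by
  rcases hp.eq_or_lt with rfl | hp
  · simp
  · rw [baseRate_of_pos hp hp1 hK]
    have h1 : p * ((1 - p) / p * (1 - (1 - p) ^ K)) = (1 - p) * (1 - (1 - p) ^ K) := by field_simp
    have h2 : 0 ≤ (1 - p) ^ K := pow_nonneg (by linarith) _
    nlinarith

theorem mul_baseRate_le_one {p : ℝ} {K : ℕ} (hp : 0 ≤ p) (hK : 1 ≤ K) : p * baseRate p K ≤ 1 := by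
  rcases le_total 1 p with h1 | h1
  · simp [baseRate_of_one_le h1]
  · linarith [mul_baseRate_le hp h1 hK]

/-- Form of `p * r(p, K) ≤ 1` for a subsystem of weight `w` with memory share `q`. It survives `w =
0`, where `q / 0 = 0` but the weight kills the rate. -/
theorem weighted_baseRate_mul_le {w q : ℝ} {K : ℕ} (hw : 0 ≤ w) (hq : 0 ≤ q) (hK : 1 ≤ K) :
    w * baseRate (q / w) K * q ≤ w ^ 2 := by
  rcases hw.eq_or_lt with rfl | hw
  · simp
  · have h := mul_baseRate_le_one (div_nonneg hq hw.le) hK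
    have : w * baseRate (q / w) K * q = w ^ 2 * (q / w * baseRate (q / w) K) := by field_simp
    rw [this]
    nlinarith [sq_nonneg w]

/-- Supplies the cut sizes: `t` is small enough for the cut memory to stay below a fixed fraction,
yet within a factor two of `1 / c`. -/
theorem exists_floor_inv {c : ℝ} (hc : 0 < c) (hc1 : c ≤ 1) :
    ∃ t : ℕ, 1 ≤ t ∧ t * c ≤ 1 ∧ 1 < (t + 1) * c := by
  refine ⟨⌊1 / c⌋₊, ?_, ?_, ?_⟩
  · rw [Nat.one_le_floor_iff, le_div_iff₀ hc]
    linarith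
  · have := Nat.floor_le (one_div_nonneg.2 hc.le)
    rwa [le_div_iff₀ hc] at this
  · have := Nat.lt_floor_add_one (1 / c)
    rwa [div_lt_iff₀ hc] at this

/-! ### Cut-set bounds against rate bounds, with memories normalized as `m = M / N` -/

section Bounds

variable {N K₁ K₂ : ℕ} {m₁ m₂ : ℝ}

theorem ratio_le_lowerBound₁ (M₁ M₂ : ℝ) {s₁ s₂ : ℕ} (h₁ : 1 ≤ s₁) (h₁' : s₁ ≤ K₁) (h₂ : 1 ≤ s₂)
    (h₂' : s₂ ≤ K₂) :
    (s₁ * s₂ : ℝ) * (N - s₁ * M₁ - s₁ * s₂ * M₂) / (N + s₁ * s₂) ≤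
      lowerBound₁ N K₁ K₂ M₁ M₂ := by
  have h : cutSet₁ N M₁ M₂ s₁ s₂ ≤ lowerBound₁ N K₁ K₂ M₁ M₂ := by
    have := le_ciSup (Set.finite_range fun s : Fin K₁ × Fin K₂ =>
      cutSet₁ N M₁ M₂ ((s.1 : ℕ) + 1) ((s.2 : ℕ) + 1)).bddAbove
      (⟨s₁ - 1, by omega⟩, ⟨s₂ - 1, by omega⟩)
    simpa only [lowerBound₁, Nat.sub_add_cancel h₁, Nat.sub_add_cancel h₂] using this
  refine le_trans ?_ h
  rw [cutSet₁]
  split_ifs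
  · exact le_max_right _ _
  · exact le_rfl

/-- The denominator `N + s₁s₂` is at most `2N`. The other expression in `cutSet₁` plays no role in
order optimality. -/
theorem half_le_lowerBound₁ (hN : K₁ * K₂ ≤ N) {s₁ s₂ : ℕ} (h₁ : 1 ≤ s₁) (h₁' : s₁ ≤ K₁)
    (h₂ : 1 ≤ s₂) (h₂' : s₂ ≤ K₂) (h : 0 ≤ 1 - s₁ * m₁ - s₁ * s₂ * m₂) :
    (s₁ * s₂ : ℝ) * (1 - s₁ * m₁ - s₁ * s₂ * m₂) / 2 ≤
      lowerBound₁ N K₁ K₂ (m₁ * N) (m₂ * N) := by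
  refine le_trans ?_ (ratio_le_lowerBound₁ _ _ h₁ h₁' h₂ h₂')
  have hs : (s₁ * s₂ : ℝ) ≤ N := by exact_mod_cast (Nat.mul_le_mul h₁' h₂').trans hN
  have hs0 : (0 : ℝ) < s₁ * s₂ := by exact_mod_cast Nat.mul_pos h₁ h₂
  have hN0 : (0 : ℝ) < N := by linarith
  have e : (s₁ * s₂ : ℝ) * (N - s₁ * (m₁ * N) - s₁ * s₂ * (m₂ * N)) =
    (s₁ * s₂ : ℝ) * (1 - s₁ * m₁ - s₁ * s₂ * m₂) * N := by ring
  rw [e, div_le_div_iff₀ (by norm_num) (by linarith)]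
  have := mul_nonneg hs0.le h
  nlinarith

theorem neg_one_le_lowerBound₁ (hK₁ : 1 ≤ K₁) (hK₂ : 1 ≤ K₂) {M₁ M₂ : ℝ} (h₁ : M₁ ≤ N)
    (h₂ : M₂ ≤ N) : -1 ≤ lowerBound₁ N K₁ K₂ M₁ M₂ := by
  refine le_trans ?_ (ratio_le_lowerBound₁ M₁ M₂ le_rfl hK₁ le_rfl hK₂)
  rw [le_div_iff₀ (by positivity)]
  push_cast
  linarith

theorem ratio_le_lowerBound₂ (M₂ : ℝ) {t : ℕ} (h : 1 ≤ t) (h' : t ≤ K₂) :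
    (t : ℝ) * (N - t * M₂) / (N + t) ≤ lowerBound₂ N K₂ M₂ := by
  have := le_ciSup (Set.finite_range fun t : Fin K₂ =>
    (((t : ℕ) + 1 : ℕ) : ℝ) * (N - ((t : ℕ) + 1 : ℕ) * M₂) / (N + ((t : ℕ) + 1 : ℕ))).bddAbove
    ⟨t - 1, by omega⟩
  simpa only [lowerBound₂, Nat.sub_add_cancel h] using this

theorem half_le_lowerBound₂ (hN : K₂ ≤ N) {t : ℕ} (h₁ : 1 ≤ t) (h₁' : t ≤ K₂)
    (h : 0 ≤ 1 - t * m₂) : (t : ℝ) * (1 - t * m₂) / 2 ≤ lowerBound₂ N K₂ (m₂ * N) := by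
  refine le_trans ?_ (ratio_le_lowerBound₂ _ h₁ h₁')
  have hs : (t : ℝ) ≤ N := by exact_mod_cast h₁'.trans hN
  have hs0 : (0 : ℝ) < t := by exact_mod_cast h₁
  have hN0 : (0 : ℝ) < N := by linarith
  have e : (t : ℝ) * (N - t * (m₂ * N)) = (t : ℝ) * (1 - t * m₂) * N := by ring
  rw [e, div_le_div_iff₀ (by norm_num) (by linarith)]
  have := mul_nonneg hs0.le h
  nlinarith

theorem zero_le_lowerBound₂ (hK₂ : 1 ≤ K₂) {M₂ : ℝ} (h₂ : M₂ ≤ N) : 0 ≤ lowerBound₂ N K₂ M₂ := by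
  refine le_trans ?_ (ratio_le_lowerBound₂ M₂ le_rfl hK₂)
  push_cast
  exact div_nonneg (by linarith) (by positivity)

/-- Covers `R₂` in all regimes: the cut uses all `K₂` users if `K₂m₂ ≤ 1/2`, and about `1 / (2m₂)`
of them otherwise. The constant `4` is the inverse of `β⋆ = 1/4`. -/
theorem scaled_le_lowerBound₂ (hK₂ : 1 ≤ K₂) (hN : K₂ ≤ N) (hm₂ : m₂ ≤ 1)
    {R : ℝ} (hR : R ≤ K₂) (hRm : R * m₂ ≤ 4) :
    1 / 60 * R - 16 ≤ lowerBound₂ N K₂ (m₂ * N) := by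
  have hK : (1 : ℝ) ≤ K₂ := by exact_mod_cast hK₂
  rcases le_total (K₂ * m₂ * 2) 1 with h1 | h1
  · have := half_le_lowerBound₂ (m₂ := m₂) hN hK₂ le_rfl (by linarith)
    nlinarith
  · have hm0 : 0 < m₂ := by
      by_contra! h
      nlinarith
    rcases lt_or_ge 1 (2 * m₂) with h2 | h2
    · have := zero_le_lowerBound₂ (N := N) (M₂ := m₂ * N) hK₂
        (mul_le_of_le_one_left (Nat.cast_nonneg _) hm₂)
      nlinarith
    · obtain ⟨t, ht1, ht2, ht3⟩ := exists_floor_inv (c := 2 * m₂) (by linarith) h2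
      have htK : t ≤ K₂ := by
        have : (t : ℝ) ≤ K₂ := by nlinarith
        exact_mod_cast this
      have hlb := half_le_lowerBound₂ (m₂ := m₂) hN ht1 htK (by linarith)
      have ht0 : (1 : ℝ) ≤ t := by exact_mod_cast ht1
      have hR' : R ≤ 8 * (t + 1) := by nlinarith
      nlinarith

/-- One mirror takes at most `1/4` of the library, and about `1 / (4m₂)` of its users at most
another `1/4`, so half of the library must still be supplied by the server. -/
theorem scaled_le_lowerBound₁_of_small_mirror (hK₁ : 1 ≤ K₁) (hK₂ : 1 ≤ K₂) (hN : K₁ * K₂ ≤ N)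
    (hm₂ : m₂ ≤ 1) (h : 1 ≤ m₁ + m₂ * K₂) (hm : m₁ ≤ 1 / 4)
    {R : ℝ} (hRm : R * m₂ ≤ 1) :
    1 / 60 * R - 16 ≤ lowerBound₁ N K₁ K₂ (m₁ * N) (m₂ * N) := by
  have hK : (1 : ℝ) ≤ K₂ := by exact_mod_cast hK₂
  have hm0 : 0 < m₂ := by
    by_contra! h
    nlinarith
  rcases lt_or_ge 1 (4 * m₂) with h2 | h2
  · have := neg_one_le_lowerBound₁ (N := N) (M₁ := m₁ * N) (M₂ := m₂ * N) hK₁ hK₂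
      (mul_le_of_le_one_left (Nat.cast_nonneg _) (by linarith))
      (mul_le_of_le_one_left (Nat.cast_nonneg _) hm₂)
    nlinarith
  · obtain ⟨t, ht1, ht2, ht3⟩ := exists_floor_inv (c := 4 * m₂) (by linarith) h2
    have htK : t ≤ K₂ := by
      have : (t : ℝ) ≤ K₂ := by nlinarith
      exact_mod_cast this
    have hlb := half_le_lowerBound₁ (m₁ := m₁) (m₂ := m₂) hN le_rfl hK₁ ht1 htK
      (by push_cast; linarith)
    push_cast at hlb
    have ht0 : (1 : ℝ) ≤ t := by exact_mod_cast ht1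
    have hR' : R ≤ 4 * (t + 1) := by nlinarith
    nlinarith

/-- One mirror leaves the fraction `d = 1 - m₁` missing; about `d / (2m₂)` users fill at most half
of it. If `d = 0`, then `m₂` may vanish and `hRm` says nothing, hence `hR1`. -/
theorem scaled_le_lowerBound₁_of_large_mirror (hK₁ : 1 ≤ K₁) (hK₂ : 1 ≤ K₂) (hN : K₁ * K₂ ≤ N)
    (hm₀ : 0 ≤ m₁) (hm₁ : m₁ ≤ 1) (hm₂ : m₂ ≤ 1) (h : 1 ≤ m₁ + m₂ * K₂)
    {R : ℝ} (hR1 : m₁ = 1 → R = 0) (hRm : R * (3 * m₂ / 4) ≤ (1 - m₁) ^ 2) :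
    1 / 60 * R - 16 ≤ lowerBound₁ N K₁ K₂ (m₁ * N) (m₂ * N) := by
  have hK : (1 : ℝ) ≤ K₂ := by exact_mod_cast hK₂
  have hneg := neg_one_le_lowerBound₁ (N := N) (M₁ := m₁ * N) (M₂ := m₂ * N) hK₁ hK₂
      (mul_le_of_le_one_left (Nat.cast_nonneg _) hm₁)
      (mul_le_of_le_one_left (Nat.cast_nonneg _) hm₂)
  rcases hm₁.eq_or_lt with h1 | h1
  · rw [hR1 h1]
    linarith
  obtain ⟨d, rfl⟩ : ∃ d, m₁ = 1 - d := ⟨1 - m₁, by ring⟩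
  have hd : 0 < d := by linarith
  have hm0 : 0 < m₂ := by
    by_contra! h
    nlinarith
  rw [sub_sub_cancel] at hRm
  rcases lt_or_ge d (2 * m₂) with h2 | h2
  · have : d * d ≤ 2 * m₂ := by nlinarith
    nlinarith
  · obtain ⟨t, ht1, ht2, ht3⟩ := exists_floor_inv (c := 2 * m₂ / d) (by positivity)
      ((div_le_one hd).2 h2)
    rw [← mul_div_assoc, div_le_one hd] at ht2
    rw [← mul_div_assoc, one_lt_div hd] at ht3
    have htK : t ≤ K₂ := by
      have : (t : ℝ) ≤ K₂ := by nlinarith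
      exact_mod_cast this
    have hlb := half_le_lowerBound₁ (m₁ := 1 - d) (m₂ := m₂) hN le_rfl hK₁ ht1 htK
      (by push_cast; linarith)
    push_cast at hlb
    have ht0 : (1 : ℝ) ≤ t := by exact_mod_cast ht1
    have hR' : R ≤ 8 / 3 * d * (t + 1) := by
      have : d * d ≤ d * ((t + 1) * (2 * m₂)) := by gcongr
      have : R * m₂ ≤ (8 / 3 * d * (t + 1)) * m₂ := by nlinarith
      exact le_of_mul_le_mul_right this hm0
    have h5 : (t : ℝ) * d / 4 ≤ 1 * t * (1 - 1 * (1 - d) - 1 * t * m₂) / 2 := by nlinarith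
    nlinarith

/-- A mirror together with all its users stores the fraction `a`. For `a ≤ 1/2` the cut takes whole
mirrors, about `1 / (2a)` of them or all. For `a > 1/2` one whole mirror would give only `K₂ * (1 -
a)`, which misses the term `m₂K₂` of the rate as `a` tends to `1`; half of its users keep both
terms. -/
theorem scaled_le_lowerBound₁_of_small_memory (hK₁ : 1 ≤ K₁) (hK₂ : 1 ≤ K₂) (hN : K₁ * K₂ ≤ N)
    (hm₁ : 0 ≤ m₁) (hm₂ : 0 ≤ m₂) {a : ℝ} (ha : a = m₁ + m₂ * K₂) (ha1 : a < 1)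
    {R : ℝ} (hR : R ≤ K₁ * K₂) (hRa : R * a ≤ K₂)
    (hRa2 : R * a ^ 2 ≤ K₂ * (m₁ * (1 - a) + m₂ * K₂)) :
    1 / 60 * R - 16 ≤ lowerBound₁ N K₁ K₂ (m₁ * N) (m₂ * N) := by
  have hK1 : (1 : ℝ) ≤ K₁ := by exact_mod_cast hK₁
  have hK2 : (1 : ℝ) ≤ K₂ := by exact_mod_cast hK₂
  have hv : 0 ≤ m₂ * K₂ := by positivity
  rcases le_or_gt a (1 / 2) with h1 | h1
  · have hcut : ∀ s₁ : ℕ, 1 ≤ s₁ → s₁ ≤ K₁ → s₁ * (2 * a) ≤ 1 →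
        (s₁ * K₂ : ℝ) / 4 ≤ lowerBound₁ N K₁ K₂ (m₁ * N) (m₂ * N) := by
      intro s₁ hs hs' hsa
      have e : 1 - s₁ * m₁ - s₁ * K₂ * m₂ = 1 - s₁ * a := by rw [ha]; ring
      have := half_le_lowerBound₁ (m₁ := m₁) (m₂ := m₂) hN hs hs' hK₂ le_rfl
        (by rw [e]; linarith)
      rw [e] at this
      have hp : (0 : ℝ) ≤ s₁ * K₂ := by positivity
      nlinarith
    rcases le_or_gt (K₁ * (2 * a)) 1 with h2 | h2
    · have := hcut K₁ hK₁ le_rfl h2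
      have hp : (0 : ℝ) ≤ K₁ * K₂ := by positivity
      linarith
    · have ha0 : 0 < a := by
        by_contra! h
        nlinarith
      obtain ⟨t, ht1, ht2, ht3⟩ := exists_floor_inv (c := 2 * a) (by linarith) (by linarith)
      have htK : t ≤ K₁ := by
        have : (t : ℝ) ≤ K₁ := by nlinarith
        exact_mod_cast this
      have := hcut t ht1 htK ht2
      have ht0 : (1 : ℝ) ≤ t := by exact_mod_cast ht1
      have hR' : R ≤ 2 * K₂ * (t + 1) := by
        have : R * a ≤ 2 * K₂ * (t + 1) * a := by nlinarith
        exact le_of_mul_le_mul_right this ha0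
      nlinarith
  · have hR4 : R ≤ 4 * (K₂ * ((1 - a) + m₂ * K₂)) := by
      have e1 : m₁ * (1 - a) ≤ 1 - a := by nlinarith
      have e2 : R * a ^ 2 ≤ K₂ * ((1 - a) + m₂ * K₂) :=
        hRa2.trans (mul_le_mul_of_nonneg_left (by linarith) (by linarith))
      rcases le_total R 0 with h | h
      · refine h.trans ?_
        have : 0 ≤ 1 - a := by linarith
        positivity
      · nlinarith
    -- A single user cannot be halved, but then `R * a ≤ 1` with `a > 1/2` bounds `R` by a constant.
    rcases hK₂.eq_or_lt with h2 | h2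
    · rw [← h2] at hRa hv ha
      have := neg_one_le_lowerBound₁ (N := N) (M₁ := m₁ * N) (M₂ := m₂ * N) hK₁ hK₂
        (mul_le_of_le_one_left (Nat.cast_nonneg _) (by linarith))
        (mul_le_of_le_one_left (Nat.cast_nonneg _) (by push_cast at ha; linarith))
      push_cast at hRa
      nlinarith
    · obtain ⟨t, ht⟩ : ∃ t, t = K₂ / 2 := ⟨_, rfl⟩
      have e1 : (2 * t : ℝ) ≤ K₂ := by exact_mod_cast (by omega : 2 * t ≤ K₂)
      have e2 : (K₂ : ℝ) ≤ 3 * t := by exact_mod_cast (by omega : K₂ ≤ 3 * t)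
      have e3 : (1 - a) + m₂ * K₂ / 2 ≤ 1 - ((1 : ℕ) : ℝ) * m₁ - ((1 : ℕ) : ℝ) * t * m₂ := by
        push_cast
        nlinarith
      have := half_le_lowerBound₁ (m₁ := m₁) (m₂ := m₂) (s₁ := 1) (s₂ := t) hN le_rfl hK₁
        (by omega) (by omega) (le_trans (by linarith) e3)
      have e4 : (K₂ : ℝ) / 3 * ((1 - a) + m₂ * K₂ / 2) / 2 ≤ ((1 : ℕ) : ℝ) * t *
          (1 - ((1 : ℕ) : ℝ) * m₁ - ((1 : ℕ) : ℝ) * t * m₂) / 2 := by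
        gcongr
        push_cast
        linarith
      have e5 : 0 ≤ K₂ * (1 - a) := mul_nonneg (by linarith) (by linarith)
      nlinarith

end Bounds

/-! ### The parameters `(α⋆, β⋆)` in the three regimes and the outer bound -/

theorem rate₁_normalized {N K₁ K₂ : ℕ} (hN : 0 < N) (m₁ m₂ α β : ℝ) :
    rate₁ N K₁ K₂ (m₁ * N) (m₂ * N) α β =
      α * K₂ * baseRate (m₁ / α) K₁ + (1 - α) * baseRate ((1 - β) * m₂ / (1 - α)) (K₁ * K₂) := by
  have : (N : ℝ) ≠ 0 := by positivity
  rw [rate₁, mul_div_mul_right _ _ this, ← mul_assoc (1 - β), mul_div_mul_right _ _ this]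

theorem rate₂_normalized {N K₂ : ℕ} (hN : 0 < N) (m₂ α β : ℝ) :
    rate₂ N K₂ (m₂ * N) α β =
      α * baseRate (β * m₂ / α) K₂ + (1 - α) * baseRate ((1 - β) * m₂ / (1 - α)) K₂ := by
  have : (N : ℝ) ≠ 0 := by positivity
  rw [rate₂, ← mul_assoc β, mul_div_mul_right _ _ this, ← mul_assoc (1 - β),
    mul_div_mul_right _ _ this]

theorem rate₂_le_natCast {N K₂ : ℕ} (hK₂ : 1 ≤ K₂) {M₂ α β : ℝ} (hM₂ : 0 ≤ M₂)
    (hα : α ∈ Set.Icc (0 : ℝ) 1) (hβ : β ∈ Set.Icc (0 : ℝ) 1) : rate₂ N K₂ M₂ α β ≤ K₂ := by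
  obtain ⟨a0, a1⟩ := hα
  obtain ⟨b0, b1⟩ := hβ
  have a2 : 0 ≤ 1 - α := by linarith
  have b2 : 0 ≤ 1 - β := by linarith
  have h1 := mul_le_mul_of_nonneg_left
    (baseRate_le_natCast (p := β * M₂ / (α * N)) (by positivity) hK₂) a0
  have h2 := mul_le_mul_of_nonneg_left
    (baseRate_le_natCast (p := (1 - β) * M₂ / ((1 - α) * N)) (by positivity) hK₂) a2
  rw [rate₂]
  linarith

theorem scaled_star_rates_le {N K₁ K₂ : ℕ} (hK₁ : 1 ≤ K₁) (hK₂ : 1 ≤ K₂) (hN : K₁ * K₂ ≤ N)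
    {M₁ M₂ : ℝ} (hM₁ : 0 ≤ M₁) (hM₂ : 0 ≤ M₂) (h₁ : M₁ ≤ N) (h₂ : M₂ ≤ N) {α β : ℝ}
    (h : (α, β) = starParams N K₂ M₁ M₂) :
    α ∈ Set.Icc (0 : ℝ) 1 ∧ β ∈ Set.Icc (0 : ℝ) 1 ∧
      1 / 60 * rate₁ N K₁ K₂ M₁ M₂ α β - 16 ≤ lowerBound₁ N K₁ K₂ M₁ M₂ ∧
      1 / 60 * rate₂ N K₂ M₂ α β - 16 ≤ lowerBound₂ N K₂ M₂ := by
  have hKK : 1 ≤ K₁ * K₂ := Nat.mul_pos hK₁ hK₂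
  have hN0 : 0 < N := hKK.trans hN
  have hNr : (0 : ℝ) < N := by exact_mod_cast hN0
  have hK1 : (1 : ℝ) ≤ K₁ := by exact_mod_cast hK₁
  have hK2 : (1 : ℝ) ≤ K₂ := by exact_mod_cast hK₂
  have hK₂N : K₂ ≤ N := (Nat.le_mul_of_pos_left _ hK₁).trans hN
  obtain ⟨m₁, rfl⟩ : ∃ m, M₁ = m * N := ⟨M₁ / N, by field_simp⟩
  obtain ⟨m₂, rfl⟩ : ∃ m, M₂ = m * N := ⟨M₂ / N, by field_simp⟩
  have hm₁ : 0 ≤ m₁ := nonneg_of_mul_nonneg_left hM₁ hNr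
  have hm₂ : 0 ≤ m₂ := nonneg_of_mul_nonneg_left hM₂ hNr
  have h₁' : m₁ ≤ 1 := by nlinarith
  have h₂' : m₂ ≤ 1 := by nlinarith
  have hA : m₁ * N + m₂ * N * K₂ = (m₁ + m₂ * K₂) * N := by ring
  have hα1 : m₁ * N / N = m₁ := by field_simp
  rw [starParams, hA, mul_div_mul_right _ _ hNr.ne', hα1] at h
  have c1 : (m₁ + m₂ * K₂) * N < N ↔ m₁ + m₂ * K₂ < 1 := by
    constructor <;> intro h <;> nlinarith
  have c2 : m₁ * N ≤ N / 4 ↔ m₁ ≤ 1 / 4 := by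
    constructor <;> intro h <;> nlinarith
  split_ifs at h with g1 g2 <;> rw [c1] at g1 <;> try rw [c2] at g2
  · obtain ⟨rfl, rfl⟩ := Prod.mk.inj h
    have hαI : m₁ / (m₁ + m₂ * K₂) ∈ Set.Icc (0 : ℝ) 1 :=
      ⟨by positivity, div_le_one_of_le₀ (by nlinarith) (by positivity)⟩
    have hβI : (0 : ℝ) ∈ Set.Icc (0 : ℝ) 1 := by simp
    refine ⟨hαI, hβI, ?_, ?_⟩
    · obtain ⟨a, ha⟩ : ∃ a, a = m₁ + m₂ * K₂ := ⟨_, rfl⟩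
      have ha0 : 0 ≤ a := by rw [ha]; positivity
      rw [rate₁_normalized hN0, ← ha]
      rw [← ha] at g1
      rcases ha0.eq_or_lt with rfl | hapos
      -- Without memory `α⋆` is `0 / 0 = 0`, as the convention requires.
      · have e1 : m₁ = 0 := by nlinarith
        have e2 : m₂ = 0 := by nlinarith
        refine scaled_le_lowerBound₁_of_small_memory hK₁ hK₂ hN hm₁ hm₂ ha g1 ?_ ?_ ?_
        · simp [e1, e2, baseRate]
        · simp
        · simp [e1, e2]
      -- This `α⋆` balances the subsystems: mirrors see normalized memory `a` in the first, and
      -- users see `a / K₂` in the second.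
      · have e1 : m₁ / a * K₂ * baseRate (m₁ / (m₁ / a)) K₁ =
            m₁ / a * K₂ * baseRate a K₁ := by
          rcases hm₁.eq_or_lt with rfl | hp
          · simp
          · rw [div_div_cancel₀ hp.ne']
        have e2 : 1 - m₁ / a = m₂ * K₂ / a := by
          rw [eq_div_iff hapos.ne', sub_mul, div_mul_cancel₀ _ hapos.ne']
          linarith
        have e3 : (1 - m₁ / a) * baseRate ((1 - 0) * m₂ / (1 - m₁ / a)) (K₁ * K₂) =
            m₂ * K₂ / a * baseRate (a / K₂) (K₁ * K₂) := by
          rw [e2]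
          rcases hm₂.eq_or_lt with rfl | hp
          · simp
          · congr 2
            field_simp
            ring
        rw [e1, e3]
        have haK : a / K₂ ≤ 1 := div_le_one_of_le₀ (by linarith) (by linarith)
        have f1 := baseRate_le_natCast hapos.le hK₁
        have f2 := baseRate_le_natCast (p := a / K₂) (by positivity) hKK
        have f3 := mul_baseRate_le hapos.le g1.le hK₁
        have f4 := mul_baseRate_le (p := a / K₂) (by positivity) haK hKK
        have f5 : a * baseRate (a / K₂) (K₁ * K₂) ≤ K₂ := by
          have : 0 ≤ a / K₂ := by positivity
          have e : a * baseRate (a / K₂) (K₁ * K₂) =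
            K₂ * (a / K₂ * baseRate (a / K₂) (K₁ * K₂)) := by field_simp
          rw [e]
          nlinarith
        generalize baseRate a K₁ = r₁ at *
        generalize baseRate (a / K₂) (K₁ * K₂) = r₂ at *
        have hsum : m₁ / a + m₂ * K₂ / a = 1 := by linarith
        have hw1 : 0 ≤ m₁ / a := by positivity
        have hw2 : 0 ≤ m₂ * K₂ / a := by positivity
        push_cast at f2
        refine scaled_le_lowerBound₁_of_small_memory hK₁ hK₂ hN hm₁ hm₂ ha g1 ?_ ?_ ?_
        · calc m₁ / a * K₂ * r₁ + m₂ * K₂ / a * r₂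
              ≤ m₁ / a * K₂ * K₁ + m₂ * K₂ / a * (K₁ * K₂) := by gcongr
            _ = (m₁ / a + m₂ * K₂ / a) * (K₁ * K₂) := by ring
            _ = K₁ * K₂ := by rw [hsum, one_mul]
        · calc (m₁ / a * K₂ * r₁ + m₂ * K₂ / a * r₂) * a
              = m₁ / a * K₂ * (a * r₁) + m₂ * K₂ / a * (a * r₂) := by ring
            _ ≤ m₁ / a * K₂ * 1 + m₂ * K₂ / a * K₂ := by gcongr; linarith
            _ = (m₁ / a + m₂ * K₂ / a) * K₂ := by ring
            _ = K₂ := by rw [hsum, one_mul]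
        · calc (m₁ / a * K₂ * r₁ + m₂ * K₂ / a * r₂) * a ^ 2
              = K₂ * m₁ * (a * r₁) + m₂ * K₂ * (a * r₂) := by field_simp
            _ ≤ K₂ * m₁ * (1 - a) + m₂ * K₂ * K₂ := by gcongr
            _ = _ := by ring
    · have hle := rate₂_le_natCast (N := N) hK₂ hM₂ hαI hβI
      refine scaled_le_lowerBound₂ hK₂ hK₂N h₂' hle ?_
      nlinarith
  · obtain ⟨rfl, rfl⟩ := Prod.mk.inj h
    have hβI : β ∈ Set.Icc (0 : ℝ) 1 := ⟨hm₁, h₁'⟩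
    have h1β : 0 < 1 - β := by linarith
    refine ⟨hβI, hβI, ?_, ?_⟩
    · refine scaled_le_lowerBound₁_of_small_mirror hK₁ hK₂ hN h₂' (not_lt.1 g1) g2 ?_
      -- Since `α⋆ = m₁`, every mirror stores the whole first part. Since `β⋆ = α⋆`, users have
      -- normalized memory `m₂` in both parts.
      have e1 : β * K₂ * baseRate (β / β) K₁ = 0 := by
        rcases hm₁.eq_or_lt with rfl | hp
        · simp
        · rw [div_self hp.ne', baseRate_of_one_le le_rfl, mul_zero]
      rw [rate₁_normalized hN0, e1, zero_add, mul_div_cancel_left₀ _ h1β.ne']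
      have := mul_baseRate_le_one hm₂ hKK
      nlinarith
    · refine scaled_le_lowerBound₂ hK₂ hK₂N h₂' (rate₂_le_natCast hK₂ hM₂ hβI hβI) ?_
      have e1 : β * baseRate (β * m₂ / β) K₂ = β * baseRate m₂ K₂ := by
        rcases hm₁.eq_or_lt with rfl | hp
        · simp
        · rw [mul_div_cancel_left₀ _ hp.ne']
      rw [rate₂_normalized hN0, e1, mul_div_cancel_left₀ _ h1β.ne']
      have := mul_baseRate_le_one hm₂ hK₂
      nlinarith
  · obtain ⟨rfl, rfl⟩ := Prod.mk.inj h
    have hαI : α ∈ Set.Icc (0 : ℝ) 1 := ⟨hm₁, h₁'⟩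
    have hβI : (1 / 4 : ℝ) ∈ Set.Icc (0 : ℝ) 1 := by norm_num
    have h1α : 0 ≤ 1 - α := by linarith
    have hα : 0 < α := by linarith
    have e34 : (1 - 1 / 4 : ℝ) * m₂ = 3 * m₂ / 4 := by ring
    refine ⟨hαI, hβI, ?_, ?_⟩
    · rw [rate₁_normalized hN0, div_self hα.ne', baseRate_of_one_le le_rfl, mul_zero, zero_add,
        e34]
      refine scaled_le_lowerBound₁_of_large_mirror hK₁ hK₂ hN hm₁ h₁' h₂' (not_lt.1 g1) ?_ ?_
      · intro h1
        simp [h1]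
      · exact weighted_baseRate_mul_le h1α (by positivity) hKK
    · refine scaled_le_lowerBound₂ hK₂ hK₂N h₂' (rate₂_le_natCast hK₂ hM₂ hαI hβI) ?_
      rw [rate₂_normalized hN0, e34]
      have w1 := weighted_baseRate_mul_le (q := 1 / 4 * m₂) hm₁ (by positivity) hK₂
      have w2 := weighted_baseRate_mul_le (q := 3 * m₂ / 4) h1α (by positivity) hK₂
      nlinarith

theorem feasibleRegion_subset_scaleShift {N K₁ K₂ : ℕ} (hK₁ : 1 ≤ K₁) (hK₂ : 1 ≤ K₂)
    (hN : K₁ * K₂ ≤ N) {M₁ M₂ : ℝ} (hM₁ : 0 ≤ M₁) (hM₂ : 0 ≤ M₂) :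
    feasibleRegion N K₁ K₂ M₁ M₂ ⊆ scaleShift (1 / 60) 16 (achievableRegion N K₁ K₂ M₁ M₂) := by
  intro R hR
  have hN0 : 0 < N := lt_of_lt_of_le (Nat.mul_pos hK₁ hK₂) hN
  have hNr : (0 : ℝ) < N := by exact_mod_cast hN0
  have hK₂N : K₂ ≤ N := (Nat.le_mul_of_pos_left _ hK₁).trans hN
  have hlb := lowerBound_le_of_mem_feasibleRegion hK₁ hK₂ hN hM₁ hM₂ hR
  have hR0 : 0 ≤ R.1 ∧ 0 ≤ R.2 := by
    have hcl : IsClosed {R : ℝ × ℝ | 0 ≤ R.1 ∧ 0 ≤ R.2} :=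
      (isClosed_le continuous_const continuous_fst).inter
        (isClosed_le continuous_const continuous_snd)
    exact closure_minimal (fun R hR => hR.nonneg) hcl hR
  suffices ∃ α ∈ Set.Icc (0 : ℝ) 1, ∃ β ∈ Set.Icc (0 : ℝ) 1,
      1 / 60 * rate₁ N K₁ K₂ M₁ M₂ α β - 16 ≤ R.1 ∧ 1 / 60 * rate₂ N K₂ M₂ α β - 16 ≤ R.2 by
    obtain ⟨α, hα, β, hβ, g1, g2⟩ := this
    refine ⟨(60 * (R.1 + 16), 60 * (R.2 + 16)), ?_, by ext <;> simp⟩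
    refine Set.mem_add.2 ⟨_, ⟨α, hα, β, hβ, rfl⟩,
      (60 * (R.1 + 16) - rate₁ N K₁ K₂ M₁ M₂ α β, 60 * (R.2 + 16) - rate₂ N K₂ M₂ α β), ?_, ?_⟩
    · constructor <;> dsimp only <;> linarith
    · ext <;> simp
  -- Beyond the range of `starParams`, extreme parameters suffice: if caches hold everything, `α = β
  -- = 0` makes both rates vanish; if mirrors do, `α = β = 1` makes `R₁` vanish. There the bound on
  -- `R.1` is just nonnegativity.
  rcases lt_or_ge (N : ℝ) M₂ with h2 | h2
  · have e : ∀ K, baseRate (M₂ / N) K = 0 := fun K =>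
      baseRate_of_one_le ((one_le_div hNr).2 h2.le)
    refine ⟨0, by simp, 0, by simp, ?_, ?_⟩
    · simp only [rate₁, zero_mul, sub_zero, one_mul, e]
      linarith
    · simp only [rate₂, zero_mul, sub_zero, one_mul, e]
      linarith
  rcases lt_or_ge (N : ℝ) M₁ with h1 | h1
  · refine ⟨1, by simp, 1, by simp, ?_, ?_⟩
    · simp only [rate₁, one_mul, sub_self, zero_mul, add_zero,
        baseRate_of_one_le ((one_le_div hNr).2 h1.le)]
      linarith
    · simp only [rate₂, one_mul, sub_self, zero_mul, add_zero]
      have hM : M₂ = M₂ / N * N := by field_simp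
      have h0 : 0 ≤ M₂ / N := by positivity
      have := scaled_le_lowerBound₂ (m₂ := M₂ / N) hK₂ hK₂N ((div_le_one hNr).2 h2)
        (baseRate_le_natCast h0 hK₂) (by linarith [mul_baseRate_le_one h0 hK₂])
      rw [← hM] at this
      linarith
  · obtain ⟨hα, hβ, g1, g2⟩ := scaled_star_rates_le hK₁ hK₂ hN hM₁ hM₂ h1 h2 rfl
    exact ⟨_, hα, _, hβ, g1.trans hlb.1, g2.trans hlb.2⟩

/-! ### Coded multicasting and the hierarchical scheme -/

section Packing

variable {β : Type*}

/-- The values of `m` on the finite set `I`, written into `x` bits. -/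
noncomputable def pack (I : Finset β) (x : ℕ) (m : β → Bool) : Bits x :=
  fun t => if h : (t : ℕ) < I.card then m (I.equivFin.symm ⟨t, h⟩) else false

open Classical in
/-- The function recovered on the finite set `I` from `x` bits. -/
noncomputable def unpack (I : Finset β) (x : ℕ) (c : Bits x) : β → Bool :=
  fun b => if h : b ∈ I then
    if h' : (I.equivFin ⟨b, h⟩ : ℕ) < x then c ⟨I.equivFin ⟨b, h⟩, h'⟩ else false else false

theorem unpack_pack {I : Finset β} {x : ℕ} (hx : I.card ≤ x) (m : β → Bool) {b : β} (hb : b ∈ I) :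
    unpack I x (pack I x m) b = m b := by
  have h' : (I.equivFin ⟨b, hb⟩ : ℕ) < x := (I.equivFin ⟨b, hb⟩).2.trans_le hx
  simp [unpack, pack, hb, h']

end Packing

section Coding

variable {κ : Type*} [Fintype κ] [DecidableEq κ]

/-- A bit position `⟨T, l⟩` is the `l`-th bit cached exactly by the users in `T`. -/
abbrev Slot (κ : Type*) : Type _ := Σ _ : Finset κ, ℕ

/-- All positions, if there are `n s` bits for every set of `s` users. -/
def positions (κ : Type*) [Fintype κ] (n : ℕ → ℕ) : Finset (Slot κ) :=
  Finset.univ.sigma fun T => Finset.range (n T.card)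

/-- The positions cached by user `k`. -/
def cached (n : ℕ → ℕ) (k : κ) : Finset (Slot κ) :=
  (Finset.univ.filter (k ∈ ·)).sigma fun T => Finset.range (n T.card)

/-- The indices of the coded bits that are useful to some user in `B`. -/
def codewords (n : ℕ → ℕ) (B : Finset κ) : Finset (Slot κ) :=
  (Finset.univ.filter fun S => (S ∩ B).Nonempty).sigma fun S => Finset.range (n (S.card - 1))

/-- The coded multicast bits: `⟨S, l⟩` is the sum over the users in `S` of the bit that this user
misses and all other users in `S` have. -/
def encode (v : κ → Slot κ → Bool) (q : Slot κ) : Bool :=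
  ∑ k ∈ q.1, v k ⟨q.1.erase k, q.2⟩

/-- What user `k` reconstructs at a position from the coded bits `c` and the cached bits `z`. -/
def decodeSlot (k : κ) (c : Slot κ → Bool) (z : κ → Slot κ → Bool) (p : Slot κ) : Bool :=
  if k ∈ p.1 then z k p
  else c ⟨insert k p.1, p.2⟩ + ∑ k' ∈ p.1, z k' ⟨(insert k p.1).erase k', p.2⟩

/-- In the coded bit for `insert k T`, each summand of another user `k'` lies at a position whose
set contains `k`, so user `k` has it cached and can cancel it. Only codewords meeting `B` are
consulted, which lets a mirror discard all others. -/
theorem decodeSlot_eq {n : ℕ → ℕ} {k : κ} {c : Slot κ → Bool} {z v : κ → Slot κ → Bool}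
    {B : Finset κ} (hk : k ∈ B) (hc : ∀ q ∈ codewords n B, c q = encode v q)
    (hz : ∀ k', ∀ q ∈ cached n k, z k' q = v k' q) {p : Slot κ} (hp : p ∈ positions κ n) :
    decodeSlot k c z p = v k p := by
  obtain ⟨T, l⟩ := p
  simp only [positions, Finset.mem_sigma, Finset.mem_univ, true_and, Finset.mem_range] at hp
  simp only [decodeSlot]
  split_ifs with hT
  · exact hz k _ (by simp [cached, hT, hp])
  · have h1 : c ⟨insert k T, l⟩ = encode v ⟨insert k T, l⟩ := by
      refine hc _ ?_
      simp only [codewords, Finset.mem_sigma, Finset.mem_filter, Finset.mem_univ, true_and,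
        Finset.mem_range, Finset.card_insert_of_notMem hT, Nat.add_sub_cancel]
      exact ⟨⟨k, by simp [hk]⟩, hp⟩
    have h2 : ∑ k' ∈ T, z k' ⟨(insert k T).erase k', l⟩ =
        ∑ k' ∈ T, v k' ⟨(insert k T).erase k', l⟩ := by
      refine Finset.sum_congr rfl fun k' hk' => hz k' _ ?_
      have hne : k ≠ k' := fun h => hT (h ▸ hk')
      have hcard : ((insert k T).erase k').card = T.card := by
        rw [Finset.card_erase_of_mem (Finset.mem_insert_of_mem hk'),
          Finset.card_insert_of_notMem hT, Nat.add_sub_cancel]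
      simp only [cached, Finset.mem_sigma, Finset.mem_filter, Finset.mem_univ, true_and,
        Finset.mem_range, hcard]
      exact ⟨by simp [hne], hp⟩
    rw [h1, h2, encode]
    simp only [Finset.sum_insert hT, Finset.erase_insert hT]
    -- Addition in `Bool` is exclusive or, so the cached sum cancels itself.
    rw [add_assoc, BooleanRing.add_self, add_zero]

end Coding

section Spread

variable {ι σ : Type*}

open Classical in
/-- The bits of `w` on `A`, moved to the positions given by `h`. -/
noncomputable def spread (A : Finset ι) (h : ι → σ) (w : ι → Bool) (p : σ) : Bool :=
  decide (∃ f ∈ A, h f = p ∧ w f = true)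

open Classical in
theorem spread_apply {A : Finset ι} {h : ι → σ} (hA : Set.InjOn h A) (w : ι → Bool) {f : ι}
    (hf : f ∈ A) : spread A h w (h f) = w f := by
  rw [spread, Bool.eq_iff_iff, decide_eq_true_iff]
  constructor
  · rintro ⟨g, hg, e, hw⟩
    rwa [← hA hg hf e]
  · exact fun hw => ⟨f, hf, rfl, hw⟩

open Classical in
theorem spread_congr {A : Finset ι} {h : ι → σ} {w w' : ι → Bool} (hw : ∀ f ∈ A, w f = w' f) :
    spread A h w = spread A h w' := by
  funext p
  rw [spread, spread, Bool.eq_iff_iff, decide_eq_true_iff, decide_eq_true_iff]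
  constructor
  · rintro ⟨f, hf, e, g⟩
    exact ⟨f, hf, e, by rw [← hw f hf, g]⟩
  · rintro ⟨f, hf, e, g⟩
    exact ⟨f, hf, e, by rw [hw f hf, g]⟩

end Spread

/-- The hierarchical coded caching scheme. The bits in `A` are delivered in two layers, first to
the mirrors and then to the users of each mirror; the others directly to all users, where each
mirror forwards the coded bits that are useful to its users. -/
theorem exists_zero_error_scheme {N K₁ K₂ F a b x y : ℕ} (A : Finset (Fin F)) {n₁ n₂ n₃ : ℕ → ℕ}
    (h₁ : Fin F → Slot (Fin K₁)) (h₂ : Fin F → Slot (Fin K₂)) (h₃ : Fin F → Slot (Fin K₁ × Fin K₂))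
    (i₁ : Set.InjOn h₁ A) (i₂ : Set.InjOn h₂ A) (i₃ : Set.InjOn h₃ (Aᶜ : Finset (Fin F)))
    (p₁ : ∀ f ∈ A, h₁ f ∈ positions _ n₁) (p₂ : ∀ f ∈ A, h₂ f ∈ positions _ n₂)
    (p₃ : ∀ f ∈ Aᶜ, h₃ f ∈ positions _ n₃)
    (ha : ∀ i : Fin K₁, N * (cached n₁ i).card ≤ a)
    (hb : ∀ (i : Fin K₁) (j : Fin K₂),
      N * (cached n₂ j).card + N * (cached n₃ (i, j)).card ≤ b)
    (hx : K₂ * (codewords n₁ (Finset.univ : Finset (Fin K₁))).card +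
      (codewords n₃ (Finset.univ : Finset (Fin K₁ × Fin K₂))).card ≤ x)
    (hy : ∀ i : Fin K₁, (codewords n₂ (Finset.univ : Finset (Fin K₂))).card +
      (codewords n₃ ({i} ×ˢ Finset.univ : Finset (Fin K₁ × Fin K₂))).card ≤ y) :
    ∃ S : Scheme N K₁ K₂ F a b x y, ∀ (D : Requests N K₁ K₂) (W : Library N F) (i : Fin K₁)
      (j : Fin K₂), S.successProb D W i j = 1 := by
  classical
  let Im (i : Fin K₁) : Finset (Fin N × Slot (Fin K₁)) := Finset.univ ×ˢ cached n₁ i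
  let Ic (i : Fin K₁) (j : Fin K₂) :
      Finset ((Fin N × Slot (Fin K₂)) ⊕ (Fin N × Slot (Fin K₁ × Fin K₂))) :=
    (Finset.univ ×ˢ cached n₂ j).disjSum (Finset.univ ×ˢ cached n₃ (i, j))
  let Is : Finset ((Fin K₂ × Slot (Fin K₁)) ⊕ Slot (Fin K₁ × Fin K₂)) :=
    (Finset.univ ×ˢ codewords n₁ Finset.univ).disjSum (codewords n₃ Finset.univ)
  let Ir (i : Fin K₁) : Finset (Slot (Fin K₂) ⊕ Slot (Fin K₁ × Fin K₂)) :=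
    (codewords n₂ Finset.univ).disjSum (codewords n₃ ({i} ×ˢ Finset.univ))
  have ca : ∀ i, (Im i).card ≤ a := fun i => by simpa [Im] using ha i
  have cb : ∀ i j, (Ic i j).card ≤ b := fun i j => by simpa [Ic] using hb i j
  have cx : Is.card ≤ x := by simpa [Is] using hx
  have cy : ∀ i, (Ir i).card ≤ y := fun i => by simpa [Ir] using hy i
  let mfun (W : Library N F) : Fin N × Slot (Fin K₁) → Bool := fun q => spread A h₁ (W q.1) q.2
  let cfun (W : Library N F) :
      (Fin N × Slot (Fin K₂)) ⊕ (Fin N × Slot (Fin K₁ × Fin K₂)) → Bool :=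
    Sum.elim (fun q => spread A h₂ (W q.1) q.2) (fun q => spread Aᶜ h₃ (W q.1) q.2)
  let sfun (D : Requests N K₁ K₂) (W : Library N F) :
      (Fin K₂ × Slot (Fin K₁)) ⊕ Slot (Fin K₁ × Fin K₂) → Bool :=
    Sum.elim (fun q => encode (fun i => spread A h₁ (W (D i q.1))) q.2)
      (encode fun k => spread Aᶜ h₃ (W (D k.1 k.2)))
  -- Mirror `i` acts as a receiver once for each `j`, decoding the `A`-bits of the file requested by
  -- its user `j`. These are all it needs to encode the second layer.
  let first (D : Requests N K₁ K₂) (i : Fin K₁) (c : Bits x) (z : Bits a) (j : Fin K₂) : Bits F :=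
    fun f => decodeSlot i (fun q => unpack Is x c (Sum.inl (j, q)))
      (fun i' q => unpack (Im i) a z (D i' j, q)) (h₁ f)
  let rfun (D : Requests N K₁ K₂) (i : Fin K₁) (c : Bits x) (z : Bits a) :
      Slot (Fin K₂) ⊕ Slot (Fin K₁ × Fin K₂) → Bool :=
    Sum.elim (encode fun j => spread A h₂ (first D i c z j))
      (fun q => unpack Is x c (Sum.inr q))
  let S : Scheme N K₁ K₂ F a b x y :=
    { seeds := 1
      -- The scheme is deterministic, hence the success probability is exactly one.
      law := PMF.pure 0
      mirror := fun _ W i => pack (Im i) a (mfun W)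
      cache := fun _ W i j => pack (Ic i j) b (cfun W)
      server := fun _ D W => pack Is x (sfun D W)
      relay := fun _ D i c z => pack (Ir i) y (rfun D i c z)
      decode := fun _ D i j r z f =>
        if f ∈ A then decodeSlot j (fun q => unpack (Ir i) y r (Sum.inl q))
          (fun j' q => unpack (Ic i j) b z (Sum.inl (D i j', q))) (h₂ f)
        else decodeSlot (i, j) (fun q => unpack (Ir i) y r (Sum.inr q))
          (fun k q => unpack (Ic i j) b z (Sum.inr (D k.1 k.2, q))) (h₃ f) }
  have key : ∀ ω D W i j, S.output ω D W i j = W (D i j) := by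
    intro ω D W i j
    have hfirst : ∀ j, ∀ f ∈ A,
        first D i (pack Is x (sfun D W)) (pack (Im i) a (mfun W)) j f = W (D i j) f := by
      intro j f hf
      refine (decodeSlot_eq (n := n₁) (v := fun i => spread A h₁ (W (D i j)))
        (Finset.mem_univ i) ?_ ?_ (p₁ f hf)).trans (spread_apply i₁ _ hf)
      · intro q hq
        rw [unpack_pack cx]
        · rfl
        · simp [Is, hq]
      · intro i' q hq
        rw [unpack_pack (ca i)]
        simp [Im, hq]
    funext f
    by_cases hf : f ∈ A
    · simp only [Scheme.output, S, if_pos hf]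
      refine (decodeSlot_eq (n := n₂) (v := fun j => spread A h₂ (W (D i j)))
        (Finset.mem_univ j) ?_ ?_ (p₂ f hf)).trans (spread_apply i₂ _ hf)
      · intro q hq
        rw [unpack_pack (cy i) _ (by simp [Ir, hq])]
        simp only [rfun, Sum.elim_inl]
        congr 1
        funext j'
        exact spread_congr (hfirst j')
      · intro j' q hq
        rw [unpack_pack (cb i j)]
        · rfl
        · simp [Ic, hq]
    · have hf' : f ∈ Aᶜ := by simpa using hf
      simp only [Scheme.output, S, if_neg hf]
      refine (decodeSlot_eq (n := n₃) (v := fun k => spread Aᶜ h₃ (W (D k.1 k.2)))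
        (B := {i} ×ˢ Finset.univ) (by simp) ?_ ?_ (p₃ f hf')).trans (spread_apply i₃ _ hf')
      · intro q hq
        rw [unpack_pack (cy i) _ (Finset.inr_mem_disjSum.2 hq)]
        simp only [rfun, Sum.elim_inr]
        rw [unpack_pack cx]
        · rfl
        · simp only [Is, Finset.inr_mem_disjSum]
          revert hq
          simp only [codewords, Finset.mem_sigma, Finset.mem_filter, Finset.mem_univ, true_and,
            Finset.inter_univ]
          exact fun h => ⟨h.1.mono Finset.inter_subset_left, h.2⟩
      · intro k q hq
        rw [unpack_pack (cb i j)]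
        · rfl
        · simp [Ic, hq]
  refine ⟨S, fun D W i j => ?_⟩
  have huniv : {ω | S.output ω D W i j = W (D i j)} = Set.univ :=
    Set.eq_univ_of_forall fun ω => key ω D W i j
  rw [Scheme.successProb, huniv, (PMF.toOuterMeasure_apply_eq_one_iff _ _).2 (Set.subset_univ _)]
  simp

/-! ### Subfile sizes and codeword counts -/

section Counting

theorem sum_weight {κ : Type*} (p : ℝ) (A : Finset κ) :
    ∑ T ∈ A.powerset, p ^ T.card * (1 - p) ^ (A.card - T.card) = 1 := by
  rw [Finset.sum_pow_mul_eq_add_pow]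
  simp

variable {κ : Type*} [Fintype κ] [DecidableEq κ]

theorem sum_weight_mem (p : ℝ) (k : κ) :
    ∑ T : Finset κ with k ∈ T, p ^ T.card * (1 - p) ^ (Fintype.card κ - T.card) = p := by
  have hcard : (Finset.univ.erase k).card + 1 = Fintype.card κ := by
    rw [Finset.card_erase_add_one (Finset.mem_univ k), Finset.card_univ]
  have h : ∑ T : Finset κ with k ∈ T, p ^ T.card * (1 - p) ^ (Fintype.card κ - T.card) =
      ∑ T ∈ (Finset.univ.erase k).powerset,
        p * (p ^ T.card * (1 - p) ^ ((Finset.univ.erase k).card - T.card)) := by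
    refine Finset.sum_nbij' (fun T => T.erase k) (fun T => insert k T) ?_ ?_ ?_ ?_ ?_
    · intro T hT
      simp only [Finset.mem_powerset]
      exact Finset.erase_subset_erase _ (Finset.subset_univ _)
    · intro T hT
      simp
    · intro T hT
      exact Finset.insert_erase (by simpa using hT)
    · intro T hT
      exact Finset.erase_insert fun h => by simpa using Finset.mem_powerset.1 hT h
    · intro T hT
      have hT' : k ∈ T := by simpa using hT
      have := Finset.card_erase_add_one hT'
      rw [← this, ← hcard, Nat.add_sub_add_right, pow_succ]
      ring
  rw [h, ← Finset.mul_sum, sum_weight, mul_one]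

theorem sum_weight_inter (p : ℝ) (B : Finset κ) :
    ∑ S : Finset κ with (S ∩ B).Nonempty, p ^ S.card * (1 - p) ^ (Fintype.card κ - S.card) =
      1 - (1 - p) ^ B.card := by
  have h1 := sum_weight p (Finset.univ : Finset κ)
  rw [Finset.powerset_univ, Finset.card_univ,
    ← Finset.sum_filter_add_sum_filter_not _ (fun S => (S ∩ B).Nonempty)] at h1
  have h2 : ∑ S : Finset κ with ¬(S ∩ B).Nonempty,
      p ^ S.card * (1 - p) ^ (Fintype.card κ - S.card) = (1 - p) ^ B.card := by
    have e : (Finset.univ.filter fun S : Finset κ => ¬(S ∩ B).Nonempty) = Bᶜ.powerset := by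
      ext S
      simp [Finset.not_nonempty_iff_eq_empty, ← Finset.disjoint_iff_inter_eq_empty,
        Finset.subset_compl_iff_disjoint_right]
    rw [e]
    have h3 := congrArg (· * (1 - p) ^ B.card) (sum_weight p Bᶜ)
    simp only [Finset.sum_mul, one_mul] at h3
    rw [← h3]
    refine Finset.sum_congr rfl fun S hS => ?_
    have c1 := Finset.card_le_card (Finset.mem_powerset.1 hS)
    have c2 := Finset.card_add_card_compl B
    rw [mul_assoc, ← pow_add]
    congr 2
    omega
  linarith

/-- Lowering the exponent by one multiplies the weight of `S` by `(1 - p) / p`, and the total weight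
of the sets meeting `B` is `1 - (1 - p) ^ B.card`. The answer depends only on `B`: forwarding to one
mirror's users costs `r(p, K₂)`, although the code is built for all `K₁K₂` users. -/
theorem sum_codeword_weight {p : ℝ} (hp : 0 ≤ p) (hp1 : p ≤ 1) {B : Finset κ}
    (hB : B.Nonempty) :
    ∑ S : Finset κ with (S ∩ B).Nonempty,
      p ^ (S.card - 1) * (1 - p) ^ (Fintype.card κ - (S.card - 1)) = baseRate p B.card := by
  have hpos : ∀ S : Finset κ, (S ∩ B).Nonempty → 1 ≤ S.card := fun S h =>
    Finset.card_pos.2 (h.mono Finset.inter_subset_left)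
  rcases hp.eq_or_lt with rfl | hp
  -- At `p = 0` only singletons survive, because `0 ^ 0 = 1`.
  · have e : ∀ S ∈ Finset.univ.filter (fun S : Finset κ => (S ∩ B).Nonempty),
        (0 : ℝ) ^ (S.card - 1) * (1 - 0) ^ (Fintype.card κ - (S.card - 1)) =
          if S.card = 1 then 1 else 0 := by
      intro S hS
      have := hpos S (by simpa using hS)
      rw [sub_zero, one_pow, mul_one, zero_pow_eq]
      congr 1
      simp only [eq_iff_iff]
      omega
    rw [Finset.sum_congr rfl e, Finset.sum_boole, baseRate, if_pos rfl, Nat.cast_inj,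
      ← Finset.card_map ⟨fun k => ({k} : Finset κ), Finset.singleton_injective⟩ (s := B)]
    congr 1
    ext S
    simp only [Finset.mem_filter, Finset.mem_univ, true_and, Finset.mem_map,
      Function.Embedding.coeFn_mk]
    constructor
    · rintro ⟨h, h1⟩
      obtain ⟨k, rfl⟩ := Finset.card_eq_one.1 h1
      obtain ⟨l, hl⟩ := h
      simp only [Finset.mem_inter, Finset.mem_singleton] at hl
      exact ⟨k, hl.1 ▸ hl.2, rfl⟩
    · rintro ⟨k, hk, rfl⟩
      exact ⟨⟨k, by simp [hk]⟩, by simp⟩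
  · rw [baseRate_of_pos hp hp1 (Finset.card_pos.2 hB), ← sum_weight_inter, Finset.mul_sum]
    refine Finset.sum_congr rfl fun S hS => ?_
    have h1 := hpos S (by simpa using hS)
    have h2 := Finset.card_le_univ S
    obtain ⟨s, hs⟩ : ∃ s, S.card = s + 1 := ⟨S.card - 1, by omega⟩
    have h3 : Fintype.card κ - s = Fintype.card κ - (s + 1) + 1 := by omega
    rw [hs, Nat.add_sub_cancel, h3, pow_succ, pow_succ]
    field_simp

/-- A placement of about `G` bits such that every user caches at most a fraction `p` of them. -/
theorem exists_placement (κ : Type*) [Fintype κ] [DecidableEq κ] {G p : ℝ} (hG : 0 ≤ G)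
    (hp : 0 ≤ p) (hp1 : p ≤ 1) :
    ∃ n : ℕ → ℕ, G + 1 ≤ (positions κ n).card ∧ (∀ k : κ, ((cached n k).card : ℝ) ≤ G * p) ∧
      ∀ B : Finset κ, B.Nonempty → ((codewords n B).card : ℝ) ≤
        G * baseRate p B.card + 2 ^ Fintype.card κ * (2 ^ Fintype.card κ + 1) := by
  obtain ⟨K, hK⟩ : ∃ K, K = Fintype.card κ := ⟨_, rfl⟩
  have hw : ∀ s, 0 ≤ G * (p ^ s * (1 - p) ^ (K - s)) := fun s => by
    have : 0 ≤ 1 - p := by linarith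
    positivity
  -- Rounding down loses at most one bit for each of the `2 ^ K` sets. The loss, and one spare bit,
  -- are made up at `s = 0`, where bits are cached by nobody and cost no memory.
  obtain ⟨n, hn⟩ : ∃ n : ℕ → ℕ, n = fun s => ⌊G * (p ^ s * (1 - p) ^ (K - s))⌋₊ +
    if s = 0 then 2 ^ K + 1 else 0 := ⟨_, rfl⟩
  have hcardF : ((Finset.univ : Finset (Finset κ)).card : ℝ) = 2 ^ K := by simp [hK]
  refine ⟨n, ?_, ?_, ?_⟩
  · have hlow : ∀ T : Finset κ, G * (p ^ T.card * (1 - p) ^ (K - T.card)) - 1 +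
        (if T = ∅ then (2 ^ K + 1 : ℝ) else 0) ≤ n T.card := by
      intro T
      rw [hn]
      have := (Nat.lt_floor_add_one (G * (p ^ T.card * (1 - p) ^ (K - T.card)))).le
      push_cast
      simp only [Finset.card_eq_zero]
      split_ifs <;> linarith
    have hsum := Finset.sum_le_sum fun T (_ : T ∈ (Finset.univ : Finset (Finset κ))) => hlow T
    have h1 := sum_weight p (Finset.univ : Finset κ)
    rw [Finset.powerset_univ, Finset.card_univ, ← hK] at h1
    rw [Finset.sum_add_distrib, Finset.sum_sub_distrib, ← Finset.mul_sum, h1,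
      Finset.sum_const, nsmul_eq_mul, hcardF] at hsum
    simp only [Finset.sum_ite_eq', Finset.mem_univ, if_true] at hsum
    rw [positions, Finset.card_sigma]
    simp only [Finset.card_range]
    push_cast
    linarith
  · intro k
    rw [cached, Finset.card_sigma]
    simp only [Finset.card_range]
    push_cast
    have h1 := sum_weight_mem p k
    rw [← hK] at h1
    rw [← h1, Finset.mul_sum]
    refine Finset.sum_le_sum fun T hT => ?_
    have hT' : T.card ≠ 0 := Finset.card_ne_zero_of_mem (a := k) (by simpa using hT)
    rw [hn]
    simp only [hT', if_false, add_zero]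
    exact Nat.floor_le (hw _)
  · intro B hB
    rw [codewords, Finset.card_sigma]
    simp only [Finset.card_range]
    push_cast
    rw [← sum_codeword_weight hp hp1 hB, ← hK, Finset.mul_sum]
    have hup : ∀ s, (n s : ℝ) ≤ G * (p ^ s * (1 - p) ^ (K - s)) + (2 ^ K + 1) := by
      intro s
      rw [hn]
      have := Nat.floor_le (hw s)
      have h0 : (0 : ℝ) ≤ 2 ^ K + 1 := by positivity
      push_cast
      split_ifs <;> linarith
    refine (Finset.sum_le_sum fun S _ => hup (S.card - 1)).trans ?_
    rw [Finset.sum_add_distrib, Finset.sum_const, nsmul_eq_mul]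
    gcongr
    rw [← hcardF]
    exact_mod_cast Finset.card_le_card (Finset.filter_subset _ _)

end Counting

/-! ### Feasibility of the achievable region -/

theorem exists_injOn_of_card_le {ι σ : Type*} [Nonempty σ] {A : Finset ι} {P : Finset σ}
    (h : A.card ≤ P.card) : ∃ f : ι → σ, Set.InjOn f A ∧ ∀ a ∈ A, f a ∈ P := by
  classical
  have : Fintype.card A ≤ Fintype.card P := by simpa using h
  obtain ⟨g⟩ := Function.Embedding.nonempty_of_card_le this
  refine ⟨fun a => if h : a ∈ A then g ⟨a, h⟩ else Classical.arbitrary σ, ?_, ?_⟩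
  · intro a ha b hb e
    rw [Finset.mem_coe] at ha hb
    simp only [dif_pos ha, dif_pos hb] at e
    simpa using g.injective (Subtype.ext e)
  · intro a ha
    simp [ha]

theorem baseRate_min_one (p : ℝ) (K : ℕ) : baseRate (min 1 p) K = baseRate p K := by
  rcases le_total p 1 with h | h
  · rw [min_eq_right h]
  · rw [min_eq_left h, baseRate_of_one_le h, baseRate_of_one_le le_rfl]

theorem mul_min_one_div_le {N : ℕ} {w M : ℝ} (hN : 0 < N) (hw : 0 ≤ w) (hM : 0 ≤ M) :
    N * (w * min 1 (M / (w * N))) ≤ M := by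
  have hN' : (0 : ℝ) < N := by exact_mod_cast hN
  rcases hw.eq_or_lt with rfl | hw
  · simpa using hM
  · calc N * (w * min 1 (M / (w * N))) ≤ N * (w * (M / (w * N))) := by
          gcongr
          exact min_le_right _ _
      _ = M := by field_simp

theorem feasible_rate_add {N K₁ K₂ : ℕ} (hK₁ : 1 ≤ K₁) (hK₂ : 1 ≤ K₂) (hN : 0 < N)
    {M₁ M₂ α β : ℝ} (hM₁ : 0 ≤ M₁) (hM₂ : 0 ≤ M₂) (hα : α ∈ Set.Icc (0 : ℝ) 1)
    (hβ : β ∈ Set.Icc (0 : ℝ) 1) {δ₁ δ₂ : ℝ} (hδ₁ : 0 < δ₁) (hδ₂ : 0 < δ₂) :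
    Feasible N K₁ K₂ M₁ M₂ (rate₁ N K₁ K₂ M₁ M₂ α β + δ₁) (rate₂ N K₂ M₂ α β + δ₂) := by
  intro ε hε
  obtain ⟨a0, a1⟩ := hα
  obtain ⟨b0, b1⟩ := hβ
  have a2 : 0 ≤ 1 - α := by linarith
  have b2 : 0 ≤ 1 - β := by linarith
  have hK₁' : Nonempty (Fin K₁) := ⟨⟨0, hK₁⟩⟩
  have hK₂' : Nonempty (Fin K₂) := ⟨⟨0, hK₂⟩⟩
  obtain ⟨C₁, hC₁⟩ : ∃ C : ℝ, C = 2 ^ Fintype.card (Fin K₁) * (2 ^ Fintype.card (Fin K₁) + 1) :=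
    ⟨_, rfl⟩
  obtain ⟨C₂, hC₂⟩ : ∃ C : ℝ, C = 2 ^ Fintype.card (Fin K₂) * (2 ^ Fintype.card (Fin K₂) + 1) :=
    ⟨_, rfl⟩
  obtain ⟨C₃, hC₃⟩ : ∃ C : ℝ, C = 2 ^ Fintype.card (Fin K₁ × Fin K₂) *
    (2 ^ Fintype.card (Fin K₁ × Fin K₂) + 1) := ⟨_, rfl⟩
  obtain ⟨p₁, hp₁⟩ : ∃ p, p = min 1 (M₁ / (α * N)) := ⟨_, rfl⟩
  obtain ⟨p₂, hp₂⟩ : ∃ p, p = min 1 (β * M₂ / (α * N)) := ⟨_, rfl⟩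
  obtain ⟨p₃, hp₃⟩ : ∃ p, p = min 1 ((1 - β) * M₂ / ((1 - α) * N)) := ⟨_, rfl⟩
  have q₁ : N * (α * p₁) ≤ M₁ := hp₁ ▸ mul_min_one_div_le hN a0 hM₁
  have q₂ : N * (α * p₂) ≤ β * M₂ := hp₂ ▸ mul_min_one_div_le hN a0 (by positivity)
  have q₃ : N * ((1 - α) * p₃) ≤ (1 - β) * M₂ := hp₃ ▸ mul_min_one_div_le hN a2 (by positivity)
  have e₁ : ∀ K, baseRate p₁ K = baseRate (M₁ / (α * N)) K := hp₁ ▸ baseRate_min_one _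
  have e₂ : ∀ K, baseRate p₂ K = baseRate (β * M₂ / (α * N)) K := hp₂ ▸ baseRate_min_one _
  have e₃ : ∀ K, baseRate p₃ K = baseRate ((1 - β) * M₂ / ((1 - α) * N)) K :=
    hp₃ ▸ baseRate_min_one _
  have z₁ : 0 ≤ p₁ := hp₁ ▸ le_min zero_le_one (by positivity)
  have z₂ : 0 ≤ p₂ := hp₂ ▸ le_min zero_le_one (by positivity)
  have z₃ : 0 ≤ p₃ := hp₃ ▸ le_min zero_le_one (by positivity)
  have o₁ : p₁ ≤ 1 := hp₁ ▸ min_le_left _ _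
  have o₂ : p₂ ≤ 1 := hp₂ ▸ min_le_left _ _
  have o₃ : p₃ ≤ 1 := hp₃ ▸ min_le_left _ _
  have hr₁ : rate₁ N K₁ K₂ M₁ M₂ α β =
      α * K₂ * baseRate p₁ K₁ + (1 - α) * baseRate p₃ (K₁ * K₂) := by rw [rate₁, e₁, e₃]
  have hr₂ : rate₂ N K₂ M₂ α β = α * baseRate p₂ K₂ + (1 - α) * baseRate p₃ K₂ := by
    rw [rate₂, e₂, e₃]
  have nn₁ := baseRate_nonneg (K := K₁) z₁
  have nn₂ := baseRate_nonneg (K := K₂) z₂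
  have nn₃ := baseRate_nonneg (K := K₂) z₃
  have nn₃' := baseRate_nonneg (K := K₁ * K₂) z₃
  -- From this file size on, the slacks `δ₁ * F` and `δ₂ * F` dominate the constant codeword
  -- overheads.
  refine ⟨max ⌈(K₂ * C₁ + C₃) / δ₁⌉₊ ⌈(C₂ + C₃) / δ₂⌉₊, fun F hF => ?_⟩
  have hF₁ : K₂ * C₁ + C₃ ≤ δ₁ * F := by
    have := Nat.ceil_le.1 ((le_max_left _ _).trans hF)
    rwa [div_le_iff₀ hδ₁, mul_comm _ δ₁] at this
  have hF₂ : C₂ + C₃ ≤ δ₂ * F := by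
    have := Nat.ceil_le.1 ((le_max_right _ _).trans hF)
    rwa [div_le_iff₀ hδ₂, mul_comm _ δ₂] at this
  have hF0 : (0 : ℝ) ≤ F := Nat.cast_nonneg F
  obtain ⟨n₁, l₁, c₁, w₁⟩ := exists_placement (Fin K₁) (mul_nonneg a0 hF0) z₁ o₁
  obtain ⟨n₂, l₂, c₂, w₂⟩ := exists_placement (Fin K₂) (mul_nonneg a0 hF0) z₂ o₂
  obtain ⟨n₃, l₃, c₃, w₃⟩ := exists_placement (Fin K₁ × Fin K₂) (mul_nonneg a2 hF0) z₃ o₃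
  have hfl : ⌊α * F⌋₊ ≤ (Finset.univ : Finset (Fin F)).card := by
    rw [Finset.card_univ, Fintype.card_fin]
    exact Nat.floor_le_of_le (mul_le_of_le_one_left hF0 a1)
  obtain ⟨A, -, hA⟩ := Finset.exists_subset_card_eq hfl
  have hA' : (A.card : ℝ) ≤ α * F := hA ▸ Nat.floor_le (mul_nonneg a0 hF0)
  -- Rounding down `A` may add one bit to the complement; the spare bit in `exists_placement`
  -- accommodates it.
  have hAc : ((Aᶜ : Finset (Fin F)).card : ℝ) ≤ (1 - α) * F + 1 := by
    have h1 := Finset.card_add_card_compl A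
    rw [Fintype.card_fin] at h1
    have h2 : (A.card : ℝ) + (Aᶜ : Finset (Fin F)).card = F := by exact_mod_cast h1
    have h3 := (Nat.lt_floor_add_one (α * F)).le
    rw [← hA] at h3
    linarith
  obtain ⟨h₁, i₁, m₁⟩ := exists_injOn_of_card_le (A := A) (P := positions (Fin K₁) n₁)
    (by have : (A.card : ℝ) ≤ _ := (by linarith : (A.card : ℝ) ≤ α * F + 1).trans l₁
        exact_mod_cast this)
  obtain ⟨h₂, i₂, m₂⟩ := exists_injOn_of_card_le (A := A) (P := positions (Fin K₂) n₂)
    (by have : (A.card : ℝ) ≤ _ := (by linarith : (A.card : ℝ) ≤ α * F + 1).trans l₂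
        exact_mod_cast this)
  obtain ⟨h₃, i₃, m₃⟩ := exists_injOn_of_card_le (A := Aᶜ) (P := positions (Fin K₁ × Fin K₂) n₃)
    (by have := hAc.trans l₃
        exact_mod_cast this)
  have hN0 : (0 : ℝ) ≤ N := Nat.cast_nonneg N
  have hr₁0 : 0 ≤ rate₁ N K₁ K₂ M₁ M₂ α β := by rw [hr₁]; positivity
  have hr₂0 : 0 ≤ rate₂ N K₂ M₂ α β := by rw [hr₂]; positivity
  obtain ⟨S, hS⟩ := exists_zero_error_scheme (N := N) (a := ⌊M₁ * F⌋₊) (b := ⌊M₂ * F⌋₊)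
    (x := ⌊(rate₁ N K₁ K₂ M₁ M₂ α β + δ₁) * F⌋₊) (y := ⌊(rate₂ N K₂ M₂ α β + δ₂) * F⌋₊)
    A h₁ h₂ h₃ i₁ i₂ i₃ m₁ m₂ m₃
    (fun i => by
      refine Nat.le_floor ?_
      push_cast
      have := mul_le_mul_of_nonneg_left (c₁ i) hN0
      linarith [mul_le_mul_of_nonneg_right q₁ hF0])
    (fun i j => by
      refine Nat.le_floor ?_
      push_cast
      have t1 := mul_le_mul_of_nonneg_left (c₂ j) hN0
      have t2 := mul_le_mul_of_nonneg_left (c₃ (i, j)) hN0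
      linarith [mul_le_mul_of_nonneg_right q₂ hF0, mul_le_mul_of_nonneg_right q₃ hF0])
    (by
      refine Nat.le_floor ?_
      push_cast
      have t1 := w₁ Finset.univ Finset.univ_nonempty
      have t2 := w₃ Finset.univ Finset.univ_nonempty
      rw [← hC₁, Finset.card_univ, Fintype.card_fin] at t1
      rw [← hC₃, Finset.card_univ, Fintype.card_prod, Fintype.card_fin, Fintype.card_fin] at t2
      have t3 := mul_le_mul_of_nonneg_left t1 (Nat.cast_nonneg (α := ℝ) K₂)
      rw [hr₁]
      linarith)
    (fun i => by
      refine Nat.le_floor ?_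
      push_cast
      have t1 := w₂ Finset.univ Finset.univ_nonempty
      have t2 := w₃ ({i} ×ˢ Finset.univ) (by simp [Finset.univ_nonempty])
      rw [← hC₂, Finset.card_univ, Fintype.card_fin] at t1
      rw [← hC₃, Finset.card_product, Finset.card_singleton, one_mul, Finset.card_univ,
        Fintype.card_fin] at t2
      rw [hr₂]
      linarith)
  refine ⟨_, _, _, _, Nat.floor_le (by positivity), Nat.floor_le (by positivity),
    Nat.floor_le (by positivity), Nat.floor_le (by positivity), S, fun D W i j => ?_⟩
  rw [hS]
  linarith

theorem achievableRegion_subset_feasibleRegion {N K₁ K₂ : ℕ} (hK₁ : 1 ≤ K₁) (hK₂ : 1 ≤ K₂)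
    (hN : 0 < N) {M₁ M₂ : ℝ} (hM₁ : 0 ≤ M₁) (hM₂ : 0 ≤ M₂) :
    achievableRegion N K₁ K₂ M₁ M₂ ⊆ feasibleRegion N K₁ K₂ M₁ M₂ := by
  intro R hR
  obtain ⟨_, ⟨α, hα, β, hβ, rfl⟩, Q, ⟨hQ1, hQ2⟩, rfl⟩ := Set.mem_add.1 hR
  rw [feasibleRegion, Metric.mem_closure_iff]
  intro ε hε
  refine ⟨(rate₁ N K₁ K₂ M₁ M₂ α β + (Q.1 + ε / 2), rate₂ N K₂ M₂ α β + (Q.2 + ε / 2)),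
    feasible_rate_add hK₁ hK₂ hN hM₁ hM₂ hα hβ (by linarith) (by linarith), ?_⟩
  have habs : ∀ r q : ℝ, |r + q - (r + (q + ε / 2))| < ε := fun r q => by
    rw [abs_lt]
    constructor <;> linarith
  rw [Prod.dist_eq, Real.dist_eq, Real.dist_eq]
  exact max_lt (habs _ _) (habs _ _)

end HierCaching

theorem theorem1 (N K₁ K₂ : ℕ) (hK₁ : 1 ≤ K₁) (hK₂ : 1 ≤ K₂) (hN : K₁ * K₂ ≤ N)
    (M₁ M₂ : ℝ) (hM₁ : 0 ≤ M₁) (hM₂ : 0 ≤ M₂) :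
    HierCaching.achievableRegion N K₁ K₂ M₁ M₂ ⊆ HierCaching.feasibleRegion N K₁ K₂ M₁ M₂ ∧
    HierCaching.feasibleRegion N K₁ K₂ M₁ M₂ ⊆
      HierCaching.scaleShift (1 / 60) 16 (HierCaching.achievableRegion N K₁ K₂ M₁ M₂) ∧
    (∀ R ∈ HierCaching.feasibleRegion N K₁ K₂ M₁ M₂,
      HierCaching.lowerBound₁ N K₁ K₂ M₁ M₂ ≤ R.1 ∧ HierCaching.lowerBound₂ N K₂ M₂ ≤ R.2) ∧
    (M₁ ≤ N → M₂ ≤ N → ∀ α β : ℝ, (α, β) = HierCaching.starParams N K₂ M₁ M₂ →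
      α ∈ Set.Icc (0 : ℝ) 1 ∧ β ∈ Set.Icc (0 : ℝ) 1 ∧
      1 / 60 * HierCaching.rate₁ N K₁ K₂ M₁ M₂ α β - 16 ≤
        HierCaching.lowerBound₁ N K₁ K₂ M₁ M₂ ∧
      1 / 60 * HierCaching.rate₂ N K₂ M₂ α β - 16 ≤ HierCaching.lowerBound₂ N K₂ M₂) :=
  ⟨HierCaching.achievableRegion_subset_feasibleRegion hK₁ hK₂
      ((Nat.mul_pos hK₁ hK₂).trans_le hN) hM₁ hM₂,
    HierCaching.feasibleRegion_subset_scaleShift hK₁ hK₂ hN hM₁ hM₂,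
    fun _ hR => HierCaching.lowerBound_le_of_mem_feasibleRegion hK₁ hK₂ hN hM₁ hM₂ hR,
    fun h₁ h₂ _ _ h => HierCaching.scaled_star_rates_le hK₁ hK₂ hN hM₁ hM₂ h₁ h₂ h⟩
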